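/- **Setting.** Let $N\ge 2$ and $\mathcal N=\{1,\dots,N\}$. For each $i\in\mathcal N$ let $\Phi_i=\rho_i+f_i$, where $\rho_i:\mathbb R^n\to\mathbb R\cup\{+\infty\}$ is closed, proper and convex, $f_i:\mathbb R^n\to\mathbb R$ is convex and differentiable on an open set containing $\operatorname{dom}\rho_i$, and $\nabla f_i$ is $L_i$-Lipschitz on $\operatorname{dom}\rho_i$. Let $A_i\in\mathbb R^{m_i\times n}$, $b_i\in\mathbb R^{m_i}$ and let $\mathcal K_i\subseteq\mathbb R^{m_i}$ be a closed convex cone containing $0$, with polar cone $\mathcal K_i^\circ$. Consider $$\min_{x\in\mathbb R^n}\ \sum_{i\in\mathcal N}\Phi_i(x)\quad\text{s.t.}\quad A_ix-b_i\in\mathcal K_i,\quad i\in\mathcal N. \tag{P}$$ The domains are bounded: $B>0$ is a number such that $\|x\|\le B$ for all $x\in\operatorname{dom}\rho_i$, $i\in\mathcal N$. All norms are Euclidean, $d_S$ is the distance to $S$, $\mathcal P_S$ the projection onto $S$, and $\sigma_S$ the support function of $S$. Put $\mathcal B_0=\{x\in\mathbb R^n:\|x\|\le B\}$, $\tilde C=\{\mathbf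 x=[x_i]_{i\in\mathcal N}\in\mathbb R^{nN}:x_1=\dots=x_N\}$, $C=\{\mathbf x\in\tilde C:\|x_1\|\le B\}$, $\Phi(\mathbf x)=\sum_i\Phi_i(x_i)$, and $$\mathcal L(\mathbf x,\theta,\lambda)=\sum_{i\in\mathcal N}\bigl(\Phi_i(x_i)+\langle\theta_i,A_ix_i-b_i\rangle-\sigma_{\mathcal K_i}(\theta_i)\bigr)+\langle\lambda,\mathbf x\rangle-\sigma_C(\lambda).$$ **Network.** For $t\ge 1$ let $\mathcal G^t=(\mathcal N,\mathcal E^t)$ be an undirected graph and $V^t\in\mathbb R^{N\times N}$ a doubly stochastic matrix. There are $\zeta\in(0,1)$ and an integer $T>1$ such that, for all $t\geq 1$, $V^t_{ij}\ge\zeta$ if $j=i$ or $j$ is a neighbour of $i$ in $\mathcal G^t$, and $V^t_{ij}=0$ otherwise; the graph $\mathcal E^\infty$ of the edges that occur in infinitely many $\mathcal E^t$ is connected; and every edge in $\mathcal E^\infty$ belongs to $\mathcal E^t\cup\dots\cup\mathcal E^{t+T-1}$ for every $t\ge1$. Put $\bar T=(N-1)T$, $\Gamma=2(1+\zeta^{-\bar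 T})/(1-\zeta^{\bar T})$, $\alpha=(1-\zeta^{\bar T})^{1/\bar T}$ and $W^{t,s}=V^tV^{t-1}\cdots V^{s+1}$ for $t\geq s+1$. **Algorithm DPDA-D.** Let $p\ge1$ be rational. Iteration $k\ge1$ uses $q_k$ consensus steps, where $q_k$ is $k^{1/p}$ rounded up or down to an integer; $t_k=\sum_{j=1}^{k-1}q_j$ steps precede it. Given step sizes $\tau_i,\kappa_i,\gamma>0$, start from $\mu^0=0$, $\theta^0=0$ and an arbitrary $\mathbf x^0$ with $x_i^0\in\operatorname{dom}\rho_i$. For $k\ge0$, iteration $k+1$ computes for all $i\in\mathcal N$ $$x_i^{k+1}=\operatorname{prox}_{\tau_i\rho_i}\bigl(x_i^k-\tau_i(\nabla f_i(x_i^k)+A_i^\top\theta_i^k+\mu_i^k)\bigr),$$ $$\mu_i^{k+1}=\mu_i^k+\gamma(2x_i^{k+1}-x_i^k)-\gamma\,\mathcal P_{\mathcal B_0}\Bigl(\sum_{j\in\mathcal N}W^{t_{k+1}+q_{k+1},\,t_{k+1}}_{ij}\bigl(\tfrac1\gamma\mu_j^k+2x_j^{k+1}-x_j^k\bigr)\Bigr),$$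 $$\theta_i^{k+1}=\mathcal P_{\mathcal K_i^\circ}\bigl(\theta_i^k+\kappa_i(A_i(2x_i^{k+1}-x_i^k)-b_i)\bigr).$$ Let $\bar{\mathbf x}^K=\frac1K\sum_{k=1}^K\mathbf x^k$. **Theorem.** Let $(\mathbf x^*,\theta^*,\lambda^*)$ be an arbitrary saddle point of $\mathcal L$ (a minimizer in $\mathbf x$ and a maximizer in $(\theta,\lambda)$), and suppose that $$\Bigl(\frac1{\tau_i}-L_i-\gamma\Bigr)\frac1{\kappa_i}\ \ge\ \sigma_{\max}^2(A_i)\qquad\text{for all } i\in\mathcal N.$$ Then $\{\bar{\mathbf x}^K\}$ has a limit point, and every limit point has the form $\mathbf 1\otimes x^{o}$, i.e. all its blocks are equal to one $x^o\in\mathbb R^n$, where $x^{o}$ is an optimal solution of (P). Moreover $\Phi(\mathbf x^*)$ and $\Phi(\bar{\mathbf x}^K)$ are finite, and for all $K\ge1$ $$\|\lambda^*\|\,d_{\tilde C}(\bar{\mathbf x}^K)+\sum_{i\in\mathcal N}\|\theta_i^*\|\,d_{\mathcal K_i}(A_i\bar x_i^K-b_i)\le\frac{\Theta_2+\Theta_3(K)}K,\qquad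 |\Phi(\bar{\mathbf x}^K)-\Phi(\mathbf x^*)|\le\frac{\Theta_2+\Theta_3(K)}K,$$ where $$\Theta_2=2\|\lambda^*\|\Bigl(\tfrac1\gamma\|\lambda^*\|+\|\mathbf x^0-\mathbf x^*\|\Bigr)+\sum_{i\in\mathcal N}\Bigl[\tfrac1{\tau_i}\|x_i^*-x_i^0\|^2+\tfrac4{\kappa_i}\|\theta_i^*\|^2\Bigr],$$ $$\Theta_3(K)=8N^2B^2\Gamma\sum_{k=1}^K\alpha^{q_k}\Bigl[2\gamma k^2+\Bigl(\gamma+\tfrac{\|\lambda^*\|}{\sqrt N B}\Bigr)k\Bigr].$$ Furthermore $\sup_K\Theta_3(K)<\infty$; hence $\Theta_3(K)/K=\mathcal O(1/K)$ and the left-hand sides of both bounds are $\mathcal O(1/K)$, while the number of communications per node in the first $K$ iterations is $\sum_{k=1}^Kq_k=\mathcal O(K^{1+1/p})$. -/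

import Mathlib

open Filter Topology
open scoped NNReal

namespace DPDA

/-- `ℝⁿ` with the Euclidean norm. -/
abbrev Vec (n : ℕ) : Type := EuclideanSpace ℝ (Fin n)

/-- `ℝ^{nN}`, vectors `𝐱 = [xᵢ]` with `N` blocks in `ℝⁿ`, with the Euclidean norm. -/
abbrev Stack (N n : ℕ) : Type := PiLp 2 (fun _ : Fin N => Vec n)

section ConvexAnalysis

variable {E : Type*} [NormedAddCommGroup E] [InnerProductSpace ℝ E]

/-- Effective domain of an extended real valued function. -/
def dom (g : E → EReal) : Set E := {x | g x ≠ ⊤}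

/-- Closed proper convex functions `E → ℝ ∪ {+∞}` (convexity of the epigraph). -/
structure IsClosedProperConvex (g : E → EReal) : Prop where
  ne_bot : ∀ x, g x ≠ ⊥
  nonempty_dom : (dom g).Nonempty
  convex_epi : Convex ℝ {p : E × ℝ | g p.1 ≤ (p.2 : EReal)}
  lsc : LowerSemicontinuous g

/-- `p = prox_{τ g}(v)`, that is, `p` minimizes `τ g(y) + ½ ‖y - v‖²` over `y`. -/
def IsProx (τ : ℝ) (g : E → EReal) (v p : E) : Prop :=
  ∀ y, (τ : EReal) * g p + ((1 / 2 * ‖p - v‖ ^ 2 : ℝ) : EReal)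
    ≤ (τ : EReal) * g y + ((1 / 2 * ‖y - v‖ ^ 2 : ℝ) : EReal)

/-- `p` is the Euclidean projection of `w` onto `S`. -/
def IsProjection (S : Set E) (w p : E) : Prop :=
  p ∈ S ∧ ∀ v ∈ S, ‖p - w‖ ≤ ‖v - w‖

/-- Polar cone `{θ | ⟨θ, w⟩ ≤ 0 for all w ∈ S}`. -/
def polar (S : Set E) : Set E := {θ | ∀ w ∈ S, inner ℝ θ w ≤ 0}

/-- Support function `σ_S(θ) = sup_{w ∈ S} ⟨θ, w⟩`. -/
noncomputable def supportFn (S : Set E) (θ : E) : EReal :=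
  ⨆ w ∈ S, ((inner ℝ θ w : ℝ) : EReal)

end ConvexAnalysis

/-- The data of `min ∑ᵢ ρᵢ(x) + fᵢ(x)` subject to `Aᵢ x - bᵢ ∈ 𝒦ᵢ` for all nodes `i`.
Mathlib's `ProperCone` is a closed convex cone containing the origin (nothing more). -/
structure Problem (N n : ℕ) (m : Fin N → ℕ) where
  rho : Fin N → Vec n → EReal
  f : Fin N → Vec n → ℝ
  A : ∀ i, Vec n →L[ℝ] Vec (m i)
  b : ∀ i, Vec (m i)
  cone : ∀ i, ProperCone ℝ (Vec (m i))

namespace Problem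

variable {N n : ℕ} {m : Fin N → ℕ} (P : Problem N n m)

/-- The composite convex model: `ρᵢ` is closed proper convex, `fᵢ : ℝⁿ → ℝ` is convex and
differentiable on an open set containing `dom ρᵢ`, and `∇fᵢ` is `Lᵢ`-Lipschitz on `dom ρᵢ`. -/
structure CompositeConvex (L : Fin N → ℝ≥0) : Prop where
  rho_convex : ∀ i, IsClosedProperConvex (P.rho i)
  f_convex : ∀ i, ConvexOn ℝ Set.univ (P.f i)
  f_diff : ∀ i, ∃ U : Set (Vec n), IsOpen U ∧ dom (P.rho i) ⊆ U ∧ DifferentiableOn ℝ (P.f i) U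
  grad_lipschitz : ∀ i, LipschitzOnWith (L i) (gradient (P.f i)) (dom (P.rho i))

/-- `Φᵢ = ρᵢ + fᵢ`. -/
noncomputable def localCost (i : Fin N) (x : Vec n) : EReal := P.rho i x + (P.f i x : EReal)

/-- `Φ(𝐱) = ∑ᵢ Φᵢ(xᵢ)`. -/
noncomputable def cost (x : Stack N n) : EReal := ∑ i, P.localCost i (x i)

/-- Feasibility `Aᵢ x - bᵢ ∈ 𝒦ᵢ` for all `i`. -/
def Feasible (x : Vec n) : Prop := ∀ i, P.A i x - P.b i ∈ P.cone i

/-- `x` is an optimal solution of `min ∑ᵢ Φᵢ(x)` subject to `Aᵢ x - bᵢ ∈ 𝒦ᵢ` for all `i`. -/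
def IsOptimal (x : Vec n) : Prop :=
  P.Feasible x ∧ ∑ i, P.localCost i x ≠ ⊤ ∧
    ∀ y, P.Feasible y → ∑ i, P.localCost i x ≤ ∑ i, P.localCost i y

end Problem

/-- The consensus subspace `C̃ = {𝐱 | all blocks of 𝐱 are equal}`. -/
def consensusSet (N n : ℕ) : Set (Stack N n) := {x | ∃ z : Vec n, ∀ i, x i = z}

/-- `C = {𝐱 | all blocks of 𝐱 are equal to one vector of norm at most B}`. -/
def boundedConsensusSet (N n : ℕ) (B : ℝ) : Set (Stack N n) :=
  {x | ∃ z : Vec n, ‖z‖ ≤ B ∧ ∀ i, x i = z}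

namespace Problem

variable {N n : ℕ} {m : Fin N → ℕ} (P : Problem N n m)

/-- `ℒ(𝐱, θ, λ) = ∑ᵢ (Φᵢ(xᵢ) + ⟨θᵢ, Aᵢ xᵢ - bᵢ⟩ - σ_{𝒦ᵢ}(θᵢ)) + ⟨λ, 𝐱⟩ - σ_C(λ)`. -/
noncomputable def lagrangian (B : ℝ) (x : Stack N n) (θ : ∀ i, Vec (m i)) (lam : Stack N n) :
    EReal :=
  ∑ i, (P.localCost i (x i) + ((inner ℝ (θ i) (P.A i (x i) - P.b i) : ℝ) : EReal)
      - supportFn (P.cone i : Set (Vec (m i))) (θ i))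
    + ((inner ℝ lam x : ℝ) : EReal) - supportFn (boundedConsensusSet N n B) lam

/-- `(𝐱*, θ*, λ*)` is a saddle point: `ℒ(𝐱*, 𝐲) ≤ ℒ(𝐱*, 𝐲*) ≤ ℒ(𝐱, 𝐲*)` for all `𝐱`, `𝐲`. -/
def IsSaddle (B : ℝ) (xs : Stack N n) (θs : ∀ i, Vec (m i)) (ls : Stack N n) : Prop :=
  (∀ (θ : ∀ i, Vec (m i)) (lam : Stack N n),
    P.lagrangian B xs θ lam ≤ P.lagrangian B xs θs ls) ∧
  ∀ x : Stack N n, P.lagrangian B xs θs ls ≤ P.lagrangian B x θs ls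

end Problem

/-- Edges that occur infinitely often. -/
def limitGraph {N : ℕ} (G : ℕ → SimpleGraph (Fin N)) : SimpleGraph (Fin N) where
  Adj i j := ∃ᶠ t in atTop, (G t).Adj i j
  symm := ⟨fun _ _ h => h.mono fun _ ht => ht.symm⟩
  loopless := ⟨fun _ h => by
    obtain ⟨_, ht⟩ := h.exists
    exact ht.ne rfl⟩

/-- The information exchange model: `V t` is the weight matrix of the `t`-th consensus step,
`t ≥ 1`, over the undirected graph `G t`. -/
structure InfoExchange {N : ℕ} (G : ℕ → SimpleGraph (Fin N)) (V : ℕ → Matrix (Fin N) (Fin N) ℝ)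
    (ζ : ℝ) (T : ℕ) : Prop where
  doubly_stochastic : ∀ t, 1 ≤ t → V t ∈ doublyStochastic ℝ (Fin N)
  zeta_mem : ζ ∈ Set.Ioo (0 : ℝ) 1
  weight_lower : ∀ t, 1 ≤ t → ∀ i j, (j = i ∨ (G t).Adj i j) → ζ ≤ V t i j
  weight_zero : ∀ t, 1 ≤ t → ∀ i j, ¬ (j = i ∨ (G t).Adj i j) → V t i j = 0
  connected : (limitGraph G).Connected
  one_lt_T : 1 < T
  intercommunication : ∀ i j, (limitGraph G).Adj i j →
    ∀ t, 1 ≤ t → ∃ s, t ≤ s ∧ s < t + T ∧ (G s).Adj i j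

/-- `W^{s+q,s} = V^{s+q} V^{s+q-1} ⋯ V^{s+1}`. -/
def mixing {N : ℕ} (V : ℕ → Matrix (Fin N) (Fin N) ℝ) (s : ℕ) : ℕ → Matrix (Fin N) (Fin N) ℝ
  | 0 => 1
  | q + 1 => V (s + q + 1) * mixing V s q

/-- Number of consensus steps performed in iterations `1, …, k`, when iteration `j` performs
`q j` of them. -/
def totalSteps (q : ℕ → ℕ) (k : ℕ) : ℕ := ∑ j ∈ Finset.Icc 1 k, q j

/-- `r = 𝓡(𝐳)`: after `q` consensus steps that follow the `s`-th one, each node projects its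
value onto the ball of radius `B`. -/
def IsApproxAverage {N n : ℕ} (V : ℕ → Matrix (Fin N) (Fin N) ℝ) (B : ℝ) (s q : ℕ)
    (z r : Stack N n) : Prop :=
  ∀ i, IsProjection (Metric.closedBall (0 : Vec n) B) (∑ j, mixing V s q i j • z j) (r i)

/-- `(x, μ, θ)` is an iterate sequence of Algorithm DPDA-D. The step from index `k` to index
`k + 1` is the `(k+1)`-st iteration, and it uses `q (k + 1)` consensus steps. -/
structure IsDPDAD {N n : ℕ} {m : Fin N → ℕ} (P : Problem N n m) (B : ℝ)
    (V : ℕ → Matrix (Fin N) (Fin N) ℝ) (q : ℕ → ℕ) (τ κ : Fin N → ℝ) (γ : ℝ)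
    (x μ : ℕ → Stack N n) (θ : ℕ → ∀ i, Vec (m i)) : Prop where
  mu_zero : μ 0 = 0
  x_step : ∀ k i, IsProx (τ i) (P.rho i)
    (x k i - τ i • (gradient (P.f i) (x k i)
      + ContinuousLinearMap.adjoint (P.A i) (θ k i) + μ k i)) (x (k + 1) i)
  mu_step : ∀ k, ∃ r : Stack N n,
    IsApproxAverage V B (totalSteps q k) (q (k + 1))
      ((1 / γ) • μ k + (2 : ℝ) • x (k + 1) - x k) r ∧
    μ (k + 1) = μ k + γ • ((2 : ℝ) • x (k + 1) - x k) - γ • r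
  theta_step : ∀ k i, IsProjection (polar (P.cone i : Set (Vec (m i))))
    (θ k i + κ i • (P.A i ((2 : ℝ) • x (k + 1) i - x k i) - P.b i)) (θ (k + 1) i)

/-- Ergodic average `𝐱̄^K = (1/K) ∑_{k=1}^K 𝐱^k`. -/
noncomputable def ergodic {N n : ℕ} (x : ℕ → Stack N n) (K : ℕ) : Stack N n :=
  (1 / (K : ℝ)) • ∑ k ∈ Finset.Icc 1 K, x k

/-- `T̄ = (N - 1) T`. -/
def Tbar (N T : ℕ) : ℕ := (N - 1) * T

/-- `Γ = 2 (1 + ζ^{-T̄}) / (1 - ζ^{T̄})`. -/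
noncomputable def Gam (N T : ℕ) (ζ : ℝ) : ℝ :=
  2 * (1 + (ζ ^ Tbar N T)⁻¹) / (1 - ζ ^ Tbar N T)

/-- `α = (1 - ζ^{T̄})^{1/T̄}`. -/
noncomputable def alph (N T : ℕ) (ζ : ℝ) : ℝ :=
  (1 - ζ ^ Tbar N T) ^ (1 / (Tbar N T : ℝ))

/-- The constant `Θ₂`. -/
noncomputable def Theta2 {N n : ℕ} {m : Fin N → ℕ} (τ κ : Fin N → ℝ) (γ : ℝ)
    (x0 xs : Stack N n) (θs : ∀ i, Vec (m i)) (ls : Stack N n) : ℝ :=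
  2 * ‖ls‖ * (1 / γ * ‖ls‖ + ‖x0 - xs‖)
    + ∑ i, (1 / τ i * ‖xs i - x0 i‖ ^ 2 + 4 / κ i * ‖θs i‖ ^ 2)

/-- The error accumulation `Θ₃(K)`. -/
noncomputable def Theta3 {N n : ℕ} (T : ℕ) (ζ B γ : ℝ) (q : ℕ → ℕ) (ls : Stack N n) (K : ℕ) : ℝ :=
  8 * (N : ℝ) ^ 2 * B ^ 2 * Gam N T ζ *
    ∑ k ∈ Finset.Icc 1 K, alph N T ζ ^ q k *
      (2 * γ * (k : ℝ) ^ 2 + (γ + ‖ls‖ / (√(N : ℝ) * B)) * (k : ℝ))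

/-- `‖λ*‖ d_{C̃}(𝐱) + ∑ᵢ ‖θᵢ*‖ d_{𝒦ᵢ}(Aᵢ xᵢ - bᵢ)`: weighted consensus violation plus weighted
conic infeasibility. -/
noncomputable def infeasibility {N n : ℕ} {m : Fin N → ℕ} (P : Problem N n m)
    (θs : ∀ i, Vec (m i)) (ls x : Stack N n) : ℝ :=
  ‖ls‖ * Metric.infDist x (consensusSet N n)
    + ∑ i, ‖θs i‖ * Metric.infDist (P.A i (x i) - P.b i) (P.cone i : Set (Vec (m i)))

end DPDA

/-!
The algorithm is a primal-dual iteration for the saddle point problem of `ℒ` in which the projection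
of `z = μ / γ + 2 x⁺ - x` onto the set `C` is replaced by the outcome `r` of finitely many consensus
steps.

*One step.* The optimality condition of the proximal step, the descent lemma for `fᵢ`, and the
variational inequality of the projection onto the polar cone add up at each node to an inequality
whose quadratic terms telescope (`node_step`). The step size condition makes the quadratic form in
the increments and the potential itself nonnegative (`quadratic_form_nonneg`). Summed over the nodes,
the terms with `r` are nonpositive if `r` is the exact projection; in general they leave an error
proportional to the distance of `r` from it (`inner_add_inner_le_of_norm_sub_le`).

*Mixing.* As the limit graph is connected and its edges recur in every window of length `T`, all
entries of a product of `T̄` weight matrices are at least `ζ ^ T̄`; so each such product contracts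
the oscillation of the columns by `1 - ζ ^ T̄` (`InfoExchange.abs_mixing_sub_le`). The iterates are
bounded and `μ` grows linearly, so the error of iteration `k` is of order `α ^ q k * k ^ 2`, which
is summable as `q k` grows like a power of `k`.

*Ergodic bounds.* Summation and Jensen's inequality bound the Lagrangian gap at the ergodic average,
for every multiplier orthogonal to the consensus subspace and every conic multiplier in the polar
cones. Multipliers along the consensus residual and along the polar parts of `Aᵢ xᵢ - bᵢ` turn this
into a bound on cost plus weighted infeasibility (`IsDPDAD.mul_residual_le`), while the saddle point
inequality bounds the cost from below by minus the infeasibility weighted with `‖λ*‖` and `‖θᵢ*‖`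
(`IsSaddleData.realCost_sub_le`). Weights `2 ‖λ*‖`, `2 ‖θᵢ*‖` give the two error bounds. Weights
`‖λ*‖ + 1`, `‖θᵢ*‖ + 1` force the unweighted residuals to zero, even where the optimal multipliers
vanish, and lower semicontinuity of the cost then makes every limit point optimal.
-/

namespace DPDA

open scoped InnerProductSpace

/-! ### Projections, cones, proximal points and the primal-dual step at one node -/

section ConvexAnalysis

variable {E : Type*} [NormedAddCommGroup E] [InnerProductSpace ℝ E]
variable {F : Type*} [NormedAddCommGroup F] [InnerProductSpace ℝ F]

theorem IsProjection.inner_le_zero {S : Set E} (hS : Convex ℝ S) {w p v : E}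
    (h : IsProjection S w p) (hv : v ∈ S) : ⟪w - p, v - p⟫_ℝ ≤ 0 := by
  refine (norm_eq_iInf_iff_real_inner_le_zero hS h.1).1 ?_ v hv
  have : Nonempty S := ⟨⟨p, h.1⟩⟩
  refine le_antisymm (le_ciInf fun u => ?_) ?_
  · rw [norm_sub_rev, norm_sub_rev w]
    exact h.2 u u.2
  · exact ciInf_le ⟨0, Set.forall_mem_range.2 fun _ => norm_nonneg _⟩ (⟨p, h.1⟩ : S)

theorem exists_isProjection [CompleteSpace E] {S : Set E} (hne : S.Nonempty) (hc : IsClosed S)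
    (hS : Convex ℝ S) (w : E) : ∃ p, IsProjection S w p := by
  obtain ⟨p, hp, h⟩ := exists_norm_eq_iInf_of_complete_convex hne hc.isComplete hS w
  refine ⟨p, hp, fun v hv => ?_⟩
  rw [norm_sub_rev, h, norm_sub_rev v]
  exact ciInf_le ⟨0, Set.forall_mem_range.2 fun _ => norm_nonneg _⟩ (⟨v, hv⟩ : S)

theorem IsProjection.norm_sub_le {S : Set E} (hS : Convex ℝ S) {w w' p p' : E}
    (h : IsProjection S w p) (h' : IsProjection S w' p') : ‖p - p'‖ ≤ ‖w - w'‖ := by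
  have h1 := h.inner_le_zero hS h'.1
  have h2 := h'.inner_le_zero hS h.1
  have h3 : ‖p - p'‖ ^ 2 ≤ ⟪w - w', p - p'⟫_ℝ := by
    rw [← real_inner_self_eq_norm_sq]
    simp only [inner_sub_left, inner_sub_right] at *
    linarith
  have h4 := real_inner_le_norm (w - w') (p - p')
  by_contra! hlt
  nlinarith [norm_nonneg (p - p'), norm_nonneg (w - w')]

theorem convex_polar (S : Set E) : Convex ℝ (polar S) := by
  intro a ha b hb s t hs ht _ w hw
  rw [inner_add_left, real_inner_smul_left, real_inner_smul_left]
  nlinarith [ha w hw, hb w hw, mul_nonneg hs (neg_nonneg.2 (ha w hw)),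
    mul_nonneg ht (neg_nonneg.2 (hb w hw))]

theorem smul_mem_polar {S : Set E} {θ : E} (h : θ ∈ polar S) {s : ℝ} (hs : 0 ≤ s) :
    s • θ ∈ polar S := fun w hw => by
  rw [real_inner_smul_left]
  exact mul_nonpos_of_nonneg_of_nonpos hs (h w hw)

/-- Moreau decomposition of a vector along a closed convex cone and its polar cone. -/
theorem exists_moreau_decomposition [CompleteSpace E] (K : ProperCone ℝ E) (w : E) :
    ∃ k ∈ K, w - k ∈ polar (K : Set E) ∧ ⟪w - k, k⟫_ℝ = 0 := by
  obtain ⟨k, hk⟩ := exists_isProjection ⟨0, K.zero_mem⟩ K.isClosed K.convex w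
  have hk' : k ∈ K := hk.1
  have hin := fun v (hv : v ∈ (K : Set E)) => hk.inner_le_zero K.convex hv
  have h1 : ⟪w - k, k⟫_ℝ ≤ 0 := by
    have := hin (k + k) (K.add_mem hk' hk')
    simpa using this
  have h2 : 0 ≤ ⟪w - k, k⟫_ℝ := by
    have := hin 0 K.zero_mem
    simpa using this
  refine ⟨k, hk', fun v hv => ?_, le_antisymm h1 h2⟩
  have := hin v hv
  rw [inner_sub_right] at this
  linarith

theorem supportFn_le {S : Set E} {θ : E} {a : ℝ} (h : ∀ w ∈ S, ⟪θ, w⟫_ℝ ≤ a) :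
    supportFn S θ ≤ a :=
  iSup₂_le fun w hw => EReal.coe_le_coe_iff.2 (h w hw)

theorem le_supportFn {S : Set E} {θ w : E} (hw : w ∈ S) : ((⟪θ, w⟫_ℝ : ℝ) : EReal) ≤ supportFn S θ :=
  le_iSup₂_of_le w hw le_rfl

theorem coe_toReal_of_mem_dom {g : E → EReal} (hg : IsClosedProperConvex g) {x : E}
    (hx : x ∈ dom g) : (((g x).toReal : ℝ) : EReal) = g x :=
  EReal.coe_toReal hx (hg.ne_bot x)

theorem IsClosedProperConvex.convexOn {g : E → EReal} (hg : IsClosedProperConvex g) :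
    ConvexOn ℝ (dom g) fun x => (g x).toReal := by
  have key : ∀ x ∈ dom g, ∀ y ∈ dom g, ∀ s t : ℝ, 0 ≤ s → 0 ≤ t → s + t = 1 →
      g (s • x + t • y) ≤ ((s * (g x).toReal + t * (g y).toReal : ℝ) : EReal) := by
    intro x hx y hy s t hs ht hst
    have h1 : (x, (g x).toReal) ∈ {p : E × ℝ | g p.1 ≤ (p.2 : EReal)} :=
      (coe_toReal_of_mem_dom hg hx).ge
    have h2 : (y, (g y).toReal) ∈ {p : E × ℝ | g p.1 ≤ (p.2 : EReal)} :=
      (coe_toReal_of_mem_dom hg hy).ge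
    simpa using hg.convex_epi h1 h2 hs ht hst
  refine ⟨fun x hx y hy s t hs ht hst => ?_, fun x hx y hy s t hs ht hst => ?_⟩
  · exact ne_top_of_le_ne_top (EReal.coe_ne_top _) (key x hx y hy s t hs ht hst)
  · have h := key x hx y hy s t hs ht hst
    have hd : s • x + t • y ∈ dom g := ne_top_of_le_ne_top (EReal.coe_ne_top _) h
    rw [← coe_toReal_of_mem_dom hg hd] at h
    exact EReal.coe_le_coe_iff.1 h

theorem IsProx.mem_dom {g : E → EReal} (hg : IsClosedProperConvex g) {τ : ℝ} (hτ : 0 < τ)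
    {v p : E} (h : IsProx τ g v p) : p ∈ dom g := by
  obtain ⟨y, hy⟩ := hg.nonempty_dom
  intro hp
  have h1 := h y
  rw [hp, EReal.coe_mul_top_of_pos hτ, EReal.top_add_coe, ← coe_toReal_of_mem_dom hg hy,
    top_le_iff] at h1
  exact EReal.coe_ne_top (τ * (g y).toReal + 1 / 2 * ‖y - v‖ ^ 2) (by exact_mod_cast h1)

/-- The optimality condition of the proximal subproblem: `(v - p) / τ` is a subgradient of `g`
at `p`. -/
theorem IsProx.add_inner_le {g : E → EReal} (hg : IsClosedProperConvex g) {τ : ℝ} (hτ : 0 < τ)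
    {v p y : E} (h : IsProx τ g v p) (hy : y ∈ dom g) :
    (g p).toReal + 1 / τ * ⟪v - p, y - p⟫_ℝ ≤ (g y).toReal := by
  have hp := h.mem_dom hg hτ
  -- compare `p` with the points of the segment from `p` to `y`, divide by `t`, and let `t → 0`
  have key : ∀ t : ℝ, 0 < t → t ≤ 1 →
      ⟪v - p, y - p⟫_ℝ ≤ τ * ((g y).toReal - (g p).toReal) + t * (1 / 2 * ‖y - p‖ ^ 2) := by
    intro t ht ht1
    have hd : (1 - t) • p + t • y ∈ dom g :=
      hg.convexOn.1 hp hy (by linarith) ht.le (by ring)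
    have h1 := h ((1 - t) • p + t • y)
    rw [← coe_toReal_of_mem_dom hg hp, ← coe_toReal_of_mem_dom hg hd] at h1
    have h2 : τ * (g p).toReal + 1 / 2 * ‖p - v‖ ^ 2 ≤
        τ * (g ((1 - t) • p + t • y)).toReal + 1 / 2 * ‖(1 - t) • p + t • y - v‖ ^ 2 := by
      exact_mod_cast h1
    have h3 : (g ((1 - t) • p + t • y)).toReal ≤ (1 - t) * (g p).toReal + t * (g y).toReal := by
      simpa using hg.convexOn.2 hp hy (show 0 ≤ 1 - t by linarith) ht.le (by ring)
    have h4 : (1 - t) • p + t • y - v = t • (y - p) - (v - p) := by module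
    have h5 : ‖p - v‖ ^ 2 = ‖v - p‖ ^ 2 := by rw [norm_sub_rev]
    rw [h4, h5, norm_sub_sq_real (t • (y - p)), real_inner_smul_left, norm_smul, Real.norm_eq_abs,
      mul_pow, sq_abs, real_inner_comm] at h2
    have h6 := mul_le_mul_of_nonneg_left h3 hτ.le
    have h7 : t * ⟪v - p, y - p⟫_ℝ ≤
        t * (τ * ((g y).toReal - (g p).toReal) + t * (1 / 2 * ‖y - p‖ ^ 2)) := by nlinarith
    exact le_of_mul_le_mul_left h7 ht
  have hlim : ⟪v - p, y - p⟫_ℝ ≤ τ * ((g y).toReal - (g p).toReal) := by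
    have ht : Tendsto (fun t : ℝ => τ * ((g y).toReal - (g p).toReal) + t * (1 / 2 * ‖y - p‖ ^ 2))
        (𝓝[>] 0) (𝓝 (τ * ((g y).toReal - (g p).toReal) + 0 * (1 / 2 * ‖y - p‖ ^ 2))) :=
      (Continuous.tendsto (by fun_prop) 0).mono_left nhdsWithin_le_nhds
    rw [zero_mul, add_zero] at ht
    refine ge_of_tendsto ht ?_
    filter_upwards [Ioo_mem_nhdsGT (zero_lt_one (α := ℝ))] with t ht
    exact key t ht.1 ht.2.le
  have : 1 / τ * ⟪v - p, y - p⟫_ℝ ≤ (g y).toReal - (g p).toReal := by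
    rw [one_div, inv_mul_le_iff₀ hτ]
    exact hlim
  linarith

/-- The derivative of a function along a segment. -/
theorem hasDerivAt_comp_segment [CompleteSpace E] {f : E → ℝ} {x d g : E} {t : ℝ}
    (h : HasGradientAt f g (x + t • d)) : HasDerivAt (fun s : ℝ => f (x + s • d)) ⟪g, d⟫_ℝ t := by
  have h1 : HasDerivAt (fun s : ℝ => x + s • d) d t := by
    simpa using ((hasDerivAt_id t).smul_const d).const_add x
  have h2 := h.hasFDerivAt.comp_hasDerivAt t h1
  rwa [InnerProductSpace.toDual_apply_apply] at h2

/-- The descent lemma on a convex set on which the gradient is Lipschitz. -/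
theorem le_add_inner_add_sq [CompleteSpace E] {f : E → ℝ} {S : Set E} (hS : Convex ℝ S) {L : ℝ≥0}
    (hg : ∀ x ∈ S, HasGradientAt f (gradient f x) x) (hL : LipschitzOnWith L (gradient f) S)
    {x y : E} (hx : x ∈ S) (hy : y ∈ S) :
    f y ≤ f x + ⟪gradient f x, y - x⟫_ℝ + L / 2 * ‖y - x‖ ^ 2 := by
  set d := y - x with hd
  have hmem : ∀ t ∈ Set.Icc (0 : ℝ) 1, x + t • d ∈ S := fun t ht =>
    hS.add_smul_sub_mem hx hy ht
  let φ : ℝ → ℝ := fun t => f (x + t • d) - t * ⟪gradient f x, d⟫_ℝ - t ^ 2 * (L / 2 * ‖d‖ ^ 2)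
  have hφ : ∀ t ∈ Set.Icc (0 : ℝ) 1, HasDerivAt φ
      (⟪gradient f (x + t • d), d⟫_ℝ - ⟪gradient f x, d⟫_ℝ - 2 * t * (L / 2 * ‖d‖ ^ 2)) t := by
    intro t ht
    have h1 := hasDerivAt_comp_segment (hg _ (hmem t ht))
    have h2 := (hasDerivAt_id t).mul_const ⟪gradient f x, d⟫_ℝ
    have h3 := ((hasDerivAt_pow 2 t)).mul_const (L / 2 * ‖d‖ ^ 2)
    have h4 := (h1.sub h2).sub h3
    rw [one_mul, Nat.cast_ofNat, pow_one] at h4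
    exact h4
  have hanti : AntitoneOn φ (Set.Icc 0 1) := by
    refine antitoneOn_of_deriv_nonpos (convex_Icc 0 1)
      (fun t ht => (hφ t ht).continuousAt.continuousWithinAt)
      (fun t ht => (hφ t (interior_subset ht)).differentiableAt.differentiableWithinAt)
      fun t ht => ?_
    have ht := interior_subset ht
    rw [(hφ t ht).deriv, ← inner_sub_left]
    have h1 := real_inner_le_norm (gradient f (x + t • d) - gradient f x) d
    have h2 := hL.norm_sub_le (hmem t ht) hx
    rw [add_sub_cancel_left, norm_smul, Real.norm_eq_abs, abs_of_nonneg ht.1] at h2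
    have h3 := mul_le_mul_of_nonneg_right h2 (norm_nonneg d)
    nlinarith
  have := hanti (Set.left_mem_Icc.2 zero_le_one) (Set.right_mem_Icc.2 zero_le_one) zero_le_one
  simp only [φ, one_smul, zero_smul, add_zero, hd, add_sub_cancel] at this
  linarith

/-- The gradient inequality of a convex function. -/
theorem add_inner_gradient_le [CompleteSpace E] {f : E → ℝ} (hf : ConvexOn ℝ Set.univ f) {x y : E}
    (hg : HasGradientAt f (gradient f x) x) : f x + ⟪gradient f x, y - x⟫_ℝ ≤ f y := by
  have hc : ConvexOn ℝ Set.univ (fun s : ℝ => f (x + s • (y - x))) := by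
    refine ⟨convex_univ, fun a _ b _ s t hs ht hst => ?_⟩
    have := hf.2 (Set.mem_univ (x + a • (y - x))) (Set.mem_univ (x + b • (y - x))) hs ht hst
    convert this using 2
    have : x = (s + t) • x := by rw [hst, one_smul]
    nth_rewrite 1 [this]
    simp only [smul_eq_mul]
    module
  have h0 : HasDerivAt (fun s : ℝ => f (x + s • (y - x))) ⟪gradient f x, y - x⟫_ℝ 0 :=
    hasDerivAt_comp_segment (by simpa using hg)
  have := hc.le_slope_of_hasDerivAt (Set.mem_univ 0) (Set.mem_univ 1) zero_lt_one h0
  rw [slope_def_field, one_smul, zero_smul, add_zero, add_sub_cancel] at this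
  linarith

/-- Under the step size condition the quadratic form that governs one primal-dual step is
nonnegative. -/
theorem quadratic_form_nonneg (A : E →L[ℝ] F) {τ κ γ L : ℝ} (hκ : 0 < κ) (hγ : 0 < γ)
    (hstep : ‖A‖ ^ 2 ≤ (1 / τ - L - γ) * (1 / κ)) (d a : E) (c : F) :
    0 ≤ 1 / (2 * τ) * ‖d‖ ^ 2 - L / 2 * ‖d‖ ^ 2 + 1 / (2 * κ) * ‖c‖ ^ 2 + 1 / (2 * γ) * ‖a‖ ^ 2
      + ⟪A d, c⟫_ℝ + ⟪d, a⟫_ℝ := by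
  have h1 : 0 ≤ γ / 2 * ‖d‖ ^ 2 + 1 / (2 * γ) * ‖a‖ ^ 2 + ⟪d, a⟫_ℝ := by
    have := sq_nonneg ‖γ • d + a‖
    rw [norm_add_sq_real, norm_smul, real_inner_smul_left, Real.norm_eq_abs, mul_pow, sq_abs] at this
    have h : γ / 2 * ‖d‖ ^ 2 + 1 / (2 * γ) * ‖a‖ ^ 2 + ⟪d, a⟫_ℝ
      = 1 / (2 * γ) * (γ ^ 2 * ‖d‖ ^ 2 + 2 * (γ * ⟪d, a⟫_ℝ) + ‖a‖ ^ 2) := by field_simp; ring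
    rw [h]; positivity
  have h2 : 0 ≤ κ / 2 * ‖A d‖ ^ 2 + 1 / (2 * κ) * ‖c‖ ^ 2 + ⟪A d, c⟫_ℝ := by
    have := sq_nonneg ‖κ • A d + c‖
    rw [norm_add_sq_real, norm_smul, real_inner_smul_left, Real.norm_eq_abs, mul_pow, sq_abs] at this
    have h : κ / 2 * ‖A d‖ ^ 2 + 1 / (2 * κ) * ‖c‖ ^ 2 + ⟪A d, c⟫_ℝ
      = 1 / (2 * κ) * (κ ^ 2 * ‖A d‖ ^ 2 + 2 * (κ * ⟪A d, c⟫_ℝ) + ‖c‖ ^ 2) := by field_simp; ring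
    rw [h]; positivity
  have h3 : κ / 2 * ‖A d‖ ^ 2 ≤ (1 / τ - L - γ) / 2 * ‖d‖ ^ 2 := by
    have h4 : ‖A d‖ ^ 2 ≤ ‖A‖ ^ 2 * ‖d‖ ^ 2 := by
      rw [← mul_pow]
      exact pow_le_pow_left₀ (norm_nonneg _) (A.le_opNorm d) 2
    have h5 : κ * ‖A‖ ^ 2 ≤ 1 / τ - L - γ := by
      have := mul_le_mul_of_nonneg_left hstep hκ.le
      field_simp at this ⊢
      linarith
    nlinarith [mul_le_mul_of_nonneg_right h5 (sq_nonneg ‖d‖)]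
  have h4 : 1 / (2 * τ) = 1 / τ / 2 := by rw [one_div, mul_inv, one_div]; ring
  rw [h4]
  linarith

/-- The Lyapunov function of the primal-dual iteration at one node, with the primal comparison
point `xs` and the dual comparison point `(ϑ, l)`. -/
noncomputable def potential (A : E →L[ℝ] F) (τ κ γ : ℝ) (xs : E) (ϑ : F) (l x μ : E) (θ : F) : ℝ :=
  1 / (2 * τ) * ‖x - xs‖ ^ 2 + 1 / (2 * κ) * ‖ϑ - θ‖ ^ 2 + 1 / (2 * γ) * ‖l - μ‖ ^ 2
    + ⟪A (x - xs), ϑ - θ⟫_ℝ + ⟪x - xs, l - μ⟫_ℝ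

theorem potential_nonneg (A : E →L[ℝ] F) {τ κ γ : ℝ} {L : ℝ≥0} (hκ : 0 < κ) (hγ : 0 < γ)
    (hstep : ‖A‖ ^ 2 ≤ (1 / τ - (L : ℝ) - γ) * (1 / κ)) (xs : E) (ϑ : F) (l x μ : E) (θ : F) :
    0 ≤ potential A τ κ γ xs ϑ l x μ θ := by
  have := quadratic_form_nonneg A hκ hγ hstep (x - xs) (l - μ) (ϑ - θ)
  have h2 : 0 ≤ (L : ℝ) / 2 * ‖x - xs‖ ^ 2 := by positivity
  unfold potential
  linarith

/-- The initial value of the Lyapunov function, with zero initial dual variables. -/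
theorem potential_zero_le (A : E →L[ℝ] F) {τ κ γ : ℝ} {L : ℝ≥0} (hκ : 0 < κ) (hγ : 0 < γ)
    (hstep : ‖A‖ ^ 2 ≤ (1 / τ - (L : ℝ) - γ) * (1 / κ)) (xs : E) (ϑ : F) (l x : E) :
    potential A τ κ γ xs ϑ l x 0 0 ≤
      1 / τ * ‖xs - x‖ ^ 2 + 1 / κ * ‖ϑ‖ ^ 2 + 1 / (2 * γ) * ‖l‖ ^ 2 + ⟪x - xs, l⟫_ℝ := by
  -- with `-γ • (x - xs)` in the second slot only the pairing of `A (x - xs)` with `ϑ` is estimated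
  have := quadratic_form_nonneg A hκ hγ hstep (x - xs) (-γ • (x - xs)) (-ϑ)
  have h2 : 0 ≤ (L : ℝ) / 2 * ‖x - xs‖ ^ 2 := by positivity
  rw [inner_smul_right, real_inner_self_eq_norm_sq, norm_smul, norm_neg, inner_neg_right, norm_neg,
    Real.norm_eq_abs, mul_pow, sq_abs] at this
  have h3 : 1 / (2 * γ) * (γ ^ 2 * ‖x - xs‖ ^ 2) = γ / 2 * ‖x - xs‖ ^ 2 := by field_simp
  have h4 : 1 / (2 * τ) = 1 / τ / 2 := by rw [one_div, mul_inv, one_div]; ring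
  have h5 : 1 / (2 * κ) = 1 / κ / 2 := by rw [one_div, mul_inv, one_div]; ring
  have h6 : 0 ≤ γ / 2 * ‖x - xs‖ ^ 2 := by positivity
  rw [h3, h4, h5] at this
  unfold potential
  rw [h4, h5, sub_zero, sub_zero, norm_sub_rev xs x]
  linarith

/-- The one-iteration inequality at one node. The vector `r` that enters the multiplier update is
arbitrary here; only the sum over the nodes of the terms `⟪xs, μ'⟫ + ⟪r, l - μ'⟫` uses that it is
close to a projected average. -/
theorem node_step [CompleteSpace E] [CompleteSpace F] (A : E →L[ℝ] F) (b : F) {ρ : E → EReal}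
    {f : E → ℝ} {τ κ γ : ℝ} {L : ℝ≥0} {S : Set F} (hρ : IsClosedProperConvex ρ)
    (hf : ConvexOn ℝ Set.univ f) (hg : ∀ x ∈ dom ρ, HasGradientAt f (gradient f x) x)
    (hL : LipschitzOnWith L (gradient f) (dom ρ)) (hτ : 0 < τ) (hκ : 0 < κ) (hγ : 0 < γ)
    (hstep : ‖A‖ ^ 2 ≤ (1 / τ - (L : ℝ) - γ) * (1 / κ)) (hS : Convex ℝ S)
    {x x' μ μ' r xs l : E} {θ θ' ϑ : F} (hx : x ∈ dom ρ)
    (hprox : IsProx τ ρ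
      (x - τ • (gradient f x + ContinuousLinearMap.adjoint A θ + μ)) x')
    (hμ : μ' = μ + γ • ((2 : ℝ) • x' - x) - γ • r)
    (hθ : IsProjection S (θ + κ • (A ((2 : ℝ) • x' - x) - b)) θ')
    (hxs : xs ∈ dom ρ) (hϑ : ϑ ∈ S) (hfeas : ⟪θ', A xs - b⟫_ℝ ≤ 0) :
    (ρ x').toReal + f x' - ((ρ xs).toReal + f xs) + ⟪ϑ, A x' - b⟫_ℝ + ⟪l, x'⟫_ℝ ≤
      ⟪xs, μ'⟫_ℝ + ⟪r, l - μ'⟫_ℝ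
        + (potential A τ κ γ xs ϑ l x μ θ - potential A τ κ γ xs ϑ l x' μ' θ') := by
  have hx' := hprox.mem_dom hρ hτ
  have h1 := hprox.add_inner_le hρ hτ hxs
  have h2 := le_add_inner_add_sq hρ.convexOn.1 hg hL hx hx'
  have h3 := add_inner_gradient_le hf (y := xs) (hg x hx)
  have h4 := hθ.inner_le_zero hS hϑ
  have h5 := quadratic_form_nonneg A hκ hγ hstep (x' - x) (μ - μ') (θ - θ')
  have hr : r = (2 : ℝ) • x' - x - (1 / γ) • (μ' - μ) := by
    have : (1 / γ) • (μ' - μ) = (2 : ℝ) • x' - x - r := by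
      rw [hμ, show μ + γ • ((2 : ℝ) • x' - x) - γ • r - μ = γ • ((2 : ℝ) • x' - x - r) by module,
        smul_smul, one_div, inv_mul_cancel₀ hγ.ne', one_smul]
    rw [this]; abel
  have h1' : 1 / τ * ⟪x - τ • (gradient f x + ContinuousLinearMap.adjoint A θ + μ) - x', xs - x'⟫_ℝ
      = 1 / τ * ⟪x - x', xs - x'⟫_ℝ
        - (⟪gradient f x, xs - x'⟫_ℝ + ⟪θ, A (xs - x')⟫_ℝ + ⟪μ, xs - x'⟫_ℝ) := by
    rw [sub_right_comm, inner_sub_left, real_inner_smul_left, inner_add_left, inner_add_left,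
      ContinuousLinearMap.adjoint_inner_left]
    field_simp
  have h4' : ⟪A ((2 : ℝ) • x' - x) - b, ϑ - θ'⟫_ℝ ≤ 1 / κ * ⟪θ' - θ, ϑ - θ'⟫_ℝ := by
    rw [show θ + κ • (A ((2 : ℝ) • x' - x) - b) - θ' = κ • (A ((2 : ℝ) • x' - x) - b) - (θ' - θ) by
      abel, inner_sub_left, real_inner_smul_left] at h4
    rw [one_div, ← div_eq_inv_mul, le_div_iff₀ hκ]
    linarith
  rw [h1'] at h1
  have e1 : 1 / (2 * τ) = 1 / τ / 2 := by rw [one_div, mul_inv, one_div]; ring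
  have e2 : 1 / (2 * κ) = 1 / κ / 2 := by rw [one_div, mul_inv, one_div]; ring
  have e3 : 1 / (2 * γ) = 1 / γ / 2 := by rw [one_div, mul_inv, one_div]; ring
  unfold potential
  rw [hr]
  rw [e1, e2, e3] at h5 ⊢
  clear hr hμ h4 h1' e1 e2 e3 hstep hprox hθ
  generalize 1 / τ = a at *
  generalize 1 / κ = c at *
  generalize 1 / γ = g at *
  generalize gradient f x = G at *
  simp only [map_sub, map_smul, inner_sub_left, inner_sub_right, real_inner_smul_left,
    ← real_inner_self_eq_norm_sq] at *
  simp only [real_inner_comm x' x, real_inner_comm xs x, real_inner_comm xs x', real_inner_comm μ x,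
    real_inner_comm μ' x, real_inner_comm μ x', real_inner_comm μ' x', real_inner_comm μ xs,
    real_inner_comm μ' xs, real_inner_comm l μ, real_inner_comm l μ', real_inner_comm μ' μ,
    real_inner_comm l x', real_inner_comm l x, real_inner_comm l xs,
    real_inner_comm ϑ θ, real_inner_comm ϑ θ', real_inner_comm θ' θ, real_inner_comm ϑ (A _),
    real_inner_comm θ (A _), real_inner_comm θ' (A _), real_inner_comm ϑ b, real_inner_comm θ' b] at *
  linarith

end ConvexAnalysis

/-! ### Mixing of the weight matrices -/

section Mixing

variable {N : ℕ} {G : ℕ → SimpleGraph (Fin N)} {V : ℕ → Matrix (Fin N) (Fin N) ℝ} {ζ : ℝ} {T : ℕ}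

theorem mixing_add (V : ℕ → Matrix (Fin N) (Fin N) ℝ) (s a b : ℕ) :
    mixing V s (a + b) = mixing V (s + a) b * mixing V s a := by
  induction b with
  | zero => simp [mixing]
  | succ b ih =>
    rw [← add_assoc, mixing, ih, mixing, Matrix.mul_assoc]
    simp only [add_assoc]

theorem InfoExchange.mixing_mem (hV : InfoExchange G V ζ T) (s q : ℕ) :
    mixing V s q ∈ doublyStochastic ℝ (Fin N) := by
  induction q with
  | zero => exact one_mem _
  | succ q ih => exact mul_mem (hV.doubly_stochastic _ (by omega)) ih

/-- One consensus step transports a weight along an edge (or a loop) at the cost of a factor `ζ`. -/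
theorem InfoExchange.pow_succ_le_mixing (hV : InfoExchange G V ζ T) {s q : ℕ} {i l j : Fin N}
    (hil : l = i ∨ (G (s + q + 1)).Adj i l) (hl : ζ ^ q ≤ mixing V s q l j) :
    ζ ^ (q + 1) ≤ mixing V s (q + 1) i j := by
  have hVm := hV.doubly_stochastic (s + q + 1) (by omega)
  have h1 := hV.weight_lower (s + q + 1) (by omega) i l hil
  have h2 : V (s + q + 1) i l * mixing V s q l j ≤ mixing V s (q + 1) i j := by
    rw [mixing, Matrix.mul_apply]
    exact Finset.single_le_sum (f := fun l => V (s + q + 1) i l * mixing V s q l j)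
      (fun l _ => mul_nonneg (nonneg_of_mem_doublyStochastic hVm)
        (nonneg_of_mem_doublyStochastic (hV.mixing_mem s q))) (Finset.mem_univ l)
  refine le_trans ?_ h2
  rw [pow_succ']
  exact mul_le_mul h1 hl (pow_nonneg hV.zeta_mem.1.le q) (hV.zeta_mem.1.le.trans h1)

theorem InfoExchange.pow_add_le_mixing (hV : InfoExchange G V ζ T) {s q : ℕ} {i j : Fin N}
    (hi : ζ ^ q ≤ mixing V s q i j) (u : ℕ) : ζ ^ (q + u) ≤ mixing V s (q + u) i j := by
  induction u with
  | zero => exact hi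
  | succ u ih => exact hV.pow_succ_le_mixing (Or.inl rfl) ih

/-- After `l T` consensus steps the value of node `j` has reached at least `l + 1` nodes: as long as
some node is not reached, an edge of the connected limit graph leaves the set of nodes that are,
and it is active once in every window of length `T`. -/
theorem InfoExchange.card_reached (hV : InfoExchange G V ζ T) (s : ℕ) (j : Fin N) (l : ℕ)
    (hl : l + 1 ≤ N) :
    l + 1 ≤ (Finset.univ.filter fun i => ζ ^ (l * T) ≤ mixing V s (l * T) i j).card := by
  induction l with
  | zero =>
    refine Finset.card_pos.2 ⟨j, ?_⟩
    simp [mixing]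
  | succ l ih =>
    have ih := ih (by omega)
    set S := Finset.univ.filter fun i => ζ ^ (l * T) ≤ mixing V s (l * T) i j with hS
    set S' := Finset.univ.filter fun i => ζ ^ ((l + 1) * T) ≤ mixing V s ((l + 1) * T) i j with hS'
    have hlT : (l + 1) * T = l * T + T := by ring
    have hsub : S ⊆ S' := by
      intro i hi
      simp only [hS, hS', Finset.mem_filter, Finset.mem_univ, true_and, hlT] at hi ⊢
      exact hV.pow_add_le_mixing hi T
    by_cases hfull : S = Finset.univ
    · have : S' = Finset.univ := Finset.univ_subset_iff.1 (hfull ▸ hsub)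
      rw [this, Finset.card_univ, Fintype.card_fin]
      exact hl
    · obtain ⟨v, hv⟩ : ∃ v, v ∉ S := by
        by_contra! h
        exact hfull (Finset.eq_univ_iff_forall.2 h)
      obtain ⟨u, hu⟩ : S.Nonempty := Finset.card_pos.1 (by omega)
      obtain ⟨w⟩ := hV.connected.preconnected u v
      obtain ⟨d, -, hd1, hd2⟩ := w.exists_boundary_dart (S : Set (Fin N)) hu hv
      obtain ⟨t, ht1, ht2, hadj⟩ := hV.intercommunication _ _ d.adj (s + l * T + 1) (by omega)
      obtain ⟨e, rfl⟩ := Nat.exists_eq_add_of_le ht1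
      have h1 : ζ ^ (l * T) ≤ mixing V s (l * T) d.fst j := by
        have hd1 : d.fst ∈ S := hd1
        simpa [hS] using hd1
      have h2 : ζ ^ (l * T + e + 1) ≤ mixing V s (l * T + e + 1) d.snd j := by
        refine hV.pow_succ_le_mixing (Or.inr ?_) (hV.pow_add_le_mixing h1 e)
        rw [show s + (l * T + e) + 1 = s + l * T + 1 + e by ring]
        exact hadj.symm
      have h3 := hV.pow_add_le_mixing h2 (T - (e + 1))
      rw [show l * T + e + 1 + (T - (e + 1)) = (l + 1) * T by rw [hlT]; omega] at h3
      have hlt : S ⊂ S' := by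
        refine (Finset.ssubset_iff_of_subset hsub).2 ⟨d.snd, ?_, hd2⟩
        simpa [hS'] using h3
      have := Finset.card_lt_card hlt
      omega

/-- After `T̄ = (N - 1) T` consensus steps all weights are at least `ζ^T̄`. -/
theorem InfoExchange.pow_Tbar_le_mixing (hV : InfoExchange G V ζ T) (hN : 1 ≤ N) (s : ℕ)
    (i j : Fin N) : ζ ^ Tbar N T ≤ mixing V s (Tbar N T) i j := by
  have h := hV.card_reached s j (N - 1) (by omega)
  have h2 : (Finset.univ.filter fun i =>
      ζ ^ ((N - 1) * T) ≤ mixing V s ((N - 1) * T) i j) = Finset.univ := by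
    refine Finset.eq_univ_of_card _ (le_antisymm (Finset.card_le_univ _) ?_)
    rw [Fintype.card_fin]
    omega
  have h3 := Finset.mem_univ i
  rw [← h2] at h3
  exact (Finset.mem_filter.1 h3).2

/-- A row-stochastic matrix whose entries are at least `δ` contracts the oscillation of a vector by
the factor `1 - δ`. -/
theorem sum_mul_sub_sum_mul_le {W : Matrix (Fin N) (Fin N) ℝ} (hW : W ∈ doublyStochastic ℝ (Fin N))
    {δ D : ℝ} (hδ : ∀ i j, δ ≤ W i j) {v : Fin N → ℝ} (hv : ∀ i j, v i - v j ≤ D) (i k : Fin N) :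
    ∑ l, W i l * v l - ∑ l, W k l * v l ≤ (1 - δ) * D := by
  have : Nonempty (Fin N) := ⟨i⟩
  obtain ⟨j, hj⟩ := Finite.exists_min v
  have hnn : ∀ i l, 0 ≤ W i l := fun i l => nonneg_of_mem_doublyStochastic hW
  have hD : 0 ≤ D := by simpa using hv i i
  have h1 : ∀ i, ∑ l, W i l * v l = v j + ∑ l, W i l * (v l - v j) := by
    intro i
    simp only [mul_sub, Finset.sum_sub_distrib, ← Finset.sum_mul,
      sum_row_of_mem_doublyStochastic hW]
    ring
  have h2 : 0 ≤ ∑ l, W k l * (v l - v j) :=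
    Finset.sum_nonneg fun l _ => mul_nonneg (hnn k l) (sub_nonneg.2 (hj l))
  have h3 : ∑ l, W i l * (v l - v j) ≤ ∑ l ∈ Finset.univ.erase j, W i l * D := by
    rw [← Finset.add_sum_erase _ _ (Finset.mem_univ j), sub_self, mul_zero, zero_add]
    exact Finset.sum_le_sum fun l _ => mul_le_mul_of_nonneg_left (hv l j) (hnn i l)
  have h4 : ∑ l ∈ Finset.univ.erase j, W i l = 1 - W i j := by
    rw [← sum_row_of_mem_doublyStochastic hW i, ← Finset.add_sum_erase _ _ (Finset.mem_univ j)]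
    ring
  rw [← Finset.sum_mul, h4] at h3
  rw [h1 i, h1 k]
  nlinarith [mul_le_mul_of_nonneg_right (hδ i j) hD]

theorem InfoExchange.mixing_sub_le (hV : InfoExchange G V ζ T) (hN : 1 ≤ N) (s r l : ℕ)
    (i k j : Fin N) :
    mixing V s (r + l * Tbar N T) i j - mixing V s (r + l * Tbar N T) k j
      ≤ (1 - ζ ^ Tbar N T) ^ l := by
  induction l generalizing i k with
  | zero =>
    have h1 := le_one_of_mem_doublyStochastic (hV.mixing_mem s (r + 0 * Tbar N T)) (i := i) (j := j)
    have h2 := nonneg_of_mem_doublyStochastic (hV.mixing_mem s (r + 0 * Tbar N T)) (i := k) (j := j)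
    rw [pow_zero]
    linarith
  | succ l ih =>
    rw [show r + (l + 1) * Tbar N T = r + l * Tbar N T + Tbar N T by ring, mixing_add,
      Matrix.mul_apply, Matrix.mul_apply, pow_succ']
    exact sum_mul_sub_sum_mul_le (hV.mixing_mem _ _) (hV.pow_Tbar_le_mixing hN _) ih i k

theorem Tbar_pos (hN : 2 ≤ N) (hT : 1 < T) : 0 < Tbar N T :=
  Nat.mul_pos (by omega) (by omega)

theorem InfoExchange.pow_Tbar_mem (hV : InfoExchange G V ζ T) (hN : 2 ≤ N) :
    ζ ^ Tbar N T ∈ Set.Ioo (0 : ℝ) 1 :=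
  ⟨pow_pos hV.zeta_mem.1 _,
    pow_lt_one₀ hV.zeta_mem.1.le hV.zeta_mem.2 (Tbar_pos hN hV.one_lt_T).ne'⟩

theorem InfoExchange.alph_mem (hV : InfoExchange G V ζ T) (hN : 2 ≤ N) :
    alph N T ζ ∈ Set.Ioo (0 : ℝ) 1 := by
  have h := hV.pow_Tbar_mem hN
  have hT : (0 : ℝ) < Tbar N T := by exact_mod_cast Tbar_pos hN hV.one_lt_T
  exact ⟨Real.rpow_pos_of_pos (by linarith [h.2]) _,
    Real.rpow_lt_one (by linarith [h.2]) (by linarith [h.1]) (by positivity)⟩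

theorem InfoExchange.Gam_pos (hV : InfoExchange G V ζ T) (hN : 2 ≤ N) : 0 < Gam N T ζ := by
  have h := hV.pow_Tbar_mem hN
  have h1 := h.1
  have h2 : 0 < 1 - ζ ^ Tbar N T := by linarith [h.2]
  unfold Gam
  positivity

/-- Geometric convergence of the mixing matrices to averaging. -/
theorem InfoExchange.abs_mixing_sub_le (hV : InfoExchange G V ζ T) (hN : 2 ≤ N) (s q : ℕ)
    (i j : Fin N) : |mixing V s q i j - 1 / N| ≤ Gam N T ζ * alph N T ζ ^ q := by
  have hδ := hV.pow_Tbar_mem hN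
  have hα := hV.alph_mem hN
  have hTb := Tbar_pos hN hV.one_lt_T
  set δ := ζ ^ Tbar N T with hδdef
  have hN0 : (0 : ℝ) < N := by exact_mod_cast (by omega : 0 < N)
  set D := (1 - δ) ^ (q / Tbar N T) with hD
  have hosc : ∀ i k, mixing V s q i j - mixing V s q k j ≤ D := by
    intro i k
    have := hV.mixing_sub_le (by omega) s (q % Tbar N T) (q / Tbar N T) i k j
    rwa [mul_comm, Nat.mod_add_div] at this
  have hcol := sum_col_of_mem_doublyStochastic (hV.mixing_mem s q) j
  have hmean : mixing V s q i j - 1 / N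
      = 1 / N * ∑ k, (mixing V s q i j - mixing V s q k j) := by
    rw [Finset.sum_sub_distrib, hcol]
    simp
    field_simp
  have h1 : |mixing V s q i j - 1 / N| ≤ D := by
    rw [hmean, abs_mul, abs_of_nonneg (by positivity : (0 : ℝ) ≤ 1 / N)]
    have h2 : |∑ k, (mixing V s q i j - mixing V s q k j)| ≤ ∑ _k : Fin N, D :=
      (Finset.abs_sum_le_sum_abs _ _).trans (Finset.sum_le_sum fun k _ =>
        abs_le.2 ⟨by linarith [hosc k i], hosc i k⟩)
    rw [Finset.sum_const, Finset.card_univ, Fintype.card_fin, nsmul_eq_mul] at h2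
    calc 1 / N * |∑ k, (mixing V s q i j - mixing V s q k j)| ≤ 1 / N * (N * D) := by gcongr
      _ = D := by field_simp
  -- `α ^ T̄ = 1 - δ`, and `q` exceeds a multiple of `T̄` by less than `T̄`
  have hpow : alph N T ζ ^ Tbar N T = 1 - δ := by
    unfold alph
    rw [← Real.rpow_natCast, ← Real.rpow_mul (by linarith [hδ.2]), one_div,
      inv_mul_cancel₀ (by exact_mod_cast hTb.ne'), Real.rpow_one]
  have h3 : D * (1 - δ) ≤ alph N T ζ ^ q := by
    rw [hD, ← pow_succ, ← hpow, ← pow_mul]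
    refine pow_le_pow_of_le_one hα.1.le hα.2.le ?_
    rw [Nat.mul_succ]
    have := Nat.mod_lt q hTb
    have := Nat.div_add_mod q (Tbar N T)
    omega
  have h4 : 1 / (1 - δ) ≤ Gam N T ζ := by
    unfold Gam
    rw [← hδdef]
    have : 0 < 1 - δ := by linarith [hδ.2]
    have : 0 < δ⁻¹ := inv_pos.2 hδ.1
    gcongr
    linarith
  have h5 : 0 < 1 - δ := by linarith [hδ.2]
  calc |mixing V s q i j - 1 / N| ≤ D := h1
    _ ≤ 1 / (1 - δ) * alph N T ζ ^ q := by
      rw [one_div, ← div_eq_inv_mul, le_div_iff₀ h5]; exact h3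
    _ ≤ _ := by have := hα.1; gcongr

end Mixing

/-! ### Sums of extended reals -/

section ExtendedReals

variable {ι : Type*}

theorem ereal_coe_sum (s : Finset ι) (a : ι → ℝ) :
    ((∑ i ∈ s, a i : ℝ) : EReal) = ∑ i ∈ s, (a i : EReal) := by
  classical
  induction s using Finset.induction_on with
  | empty => simp
  | insert i s hi ih => rw [Finset.sum_insert hi, Finset.sum_insert hi, EReal.coe_add, ih]

theorem ereal_sum_ne_bot (s : Finset ι) {a : ι → EReal} (h : ∀ i, a i ≠ ⊥) : ∑ i ∈ s, a i ≠ ⊥ := by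
  classical
  induction s using Finset.induction_on with
  | empty => simp
  | insert i s hi ih =>
    rw [Finset.sum_insert hi]
    exact EReal.add_ne_bot_iff.2 ⟨h i, ih⟩

theorem ereal_ne_top_of_sum_ne_top [Fintype ι] {a : ι → EReal} (hb : ∀ i, a i ≠ ⊥)
    (h : ∑ i, a i ≠ ⊤) (i : ι) : a i ≠ ⊤ := by
  classical
  intro hi
  rw [← Finset.add_sum_erase _ _ (Finset.mem_univ i), hi,
    EReal.top_add_of_ne_bot (ereal_sum_ne_bot _ hb)] at h
  exact h rfl

end ExtendedReals

/-! ### Consensus residuals of stacked vectors -/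

section Stacks

variable {N n : ℕ}

/-- The stacked vector `𝟏 ⊗ z`. -/
noncomputable def constStack (N : ℕ) {n : ℕ} (z : Vec n) : Stack N n := WithLp.toLp 2 fun _ => z

@[simp] theorem constStack_apply (z : Vec n) (i : Fin N) : constStack N z i = z := rfl

/-- The average of the blocks of a stacked vector. -/
noncomputable def blockMean (x : Stack N n) : Vec n := (1 / (N : ℝ)) • ∑ i, x i

/-- The consensus residual `𝐱 - 𝒫_{C̃}(𝐱)`. -/
noncomputable def consensusResidual (x : Stack N n) : Stack N n := x - constStack N (blockMean x)

theorem sum_eq_smul_blockMean (hN : 0 < N) (x : Stack N n) : ∑ i, x i = (N : ℝ) • blockMean x := by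
  have : (N : ℝ) ≠ 0 := by exact_mod_cast hN.ne'
  rw [blockMean, smul_smul, mul_one_div_cancel this, one_smul]

theorem inner_consensusResidual_constStack (hN : 0 < N) (x : Stack N n) (z : Vec n) :
    ⟪consensusResidual x, constStack N z⟫_ℝ = 0 := by
  rw [PiLp.inner_apply]
  simp only [consensusResidual, PiLp.sub_apply, constStack_apply]
  rw [← sum_inner, Finset.sum_sub_distrib, sum_eq_smul_blockMean hN, Finset.sum_const,
    Finset.card_univ, Fintype.card_fin, Nat.cast_smul_eq_nsmul, sub_self, inner_zero_left]

theorem inner_consensusResidual_self (hN : 0 < N) (x : Stack N n) :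
    ⟪consensusResidual x, x⟫_ℝ = ‖consensusResidual x‖ ^ 2 := by
  have h := inner_consensusResidual_constStack hN x (blockMean x)
  have h2 : x = consensusResidual x + constStack N (blockMean x) := by
    rw [consensusResidual, sub_add_cancel]
  nth_rewrite 2 [h2]
  rw [inner_add_right, h, add_zero, real_inner_self_eq_norm_sq]

theorem infDist_consensusSet_le (x : Stack N n) :
    Metric.infDist x (consensusSet N n) ≤ ‖consensusResidual x‖ := by
  rw [consensusResidual, ← dist_eq_norm]
  exact Metric.infDist_le_dist_of_mem ⟨blockMean x, fun _ => rfl⟩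

theorem norm_blockMean_le (hN : 0 < N) {x : Stack N n} {B : ℝ} (h : ∀ i, ‖x i‖ ≤ B) :
    ‖blockMean x‖ ≤ B := by
  have hN' : (0 : ℝ) < N := by exact_mod_cast hN
  rw [blockMean, norm_smul, Real.norm_of_nonneg (by positivity), one_div, inv_mul_le_iff₀ hN']
  simpa using (norm_sum_le _ _).trans (Finset.sum_le_sum fun i (_ : i ∈ Finset.univ) => h i)

theorem norm_stack_le {x : Stack N n} {B : ℝ} (hB : 0 ≤ B) (h : ∀ i, ‖x i‖ ≤ B) :
    ‖x‖ ≤ √(N : ℝ) * B := by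
  refine le_of_sq_le_sq ?_ (by positivity)
  rw [PiLp.norm_sq_eq_of_L2, mul_pow, Real.sq_sqrt (Nat.cast_nonneg N)]
  calc ∑ i, ‖x i‖ ^ 2 ≤ ∑ _i : Fin N, B ^ 2 :=
        Finset.sum_le_sum fun i _ => pow_le_pow_left₀ (norm_nonneg _) (h i) 2
    _ = N * B ^ 2 := by simp

end Stacks

/-! ### Saddle points -/

section SaddlePoint

variable {N n : ℕ} {m : Fin N → ℕ} {P : Problem N n m} {L : Fin N → ℝ≥0} {B : ℝ}

namespace Problem

/-- The real value of `Φ(𝐱)` at points where it is finite. -/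
noncomputable def realCost (P : Problem N n m) (x : Stack N n) : ℝ :=
  ∑ i, ((P.rho i (x i)).toReal + P.f i (x i))

theorem CompositeConvex.localCost_ne_bot (hP : P.CompositeConvex L) (i : Fin N) (x : Vec n) :
    P.localCost i x ≠ ⊥ :=
  EReal.add_ne_bot_iff.2 ⟨(hP.rho_convex i).ne_bot x, EReal.coe_ne_bot _⟩

theorem CompositeConvex.localCost_eq (hP : P.CompositeConvex L) {i : Fin N} {x : Vec n}
    (hx : x ∈ dom (P.rho i)) :
    P.localCost i x = (((P.rho i x).toReal + P.f i x : ℝ) : EReal) := by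
  rw [localCost, EReal.coe_add, coe_toReal_of_mem_dom (hP.rho_convex i) hx]

theorem CompositeConvex.cost_eq (hP : P.CompositeConvex L) {x : Stack N n}
    (hx : ∀ i, x i ∈ dom (P.rho i)) : P.cost x = (P.realCost x : EReal) := by
  rw [cost, realCost, ereal_coe_sum]
  exact Finset.sum_congr rfl fun i _ => hP.localCost_eq (hx i)

theorem CompositeConvex.mem_dom_of_sum_ne_top (hP : P.CompositeConvex L) {x : Fin N → Vec n}
    (h : ∑ i, P.localCost i (x i) ≠ ⊤) (i : Fin N) : x i ∈ dom (P.rho i) := by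
  intro hi
  refine ereal_ne_top_of_sum_ne_top (fun i => hP.localCost_ne_bot i (x i)) h i ?_
  rw [localCost, hi, EReal.top_add_coe]

/-- Replacing each support function by its value at one point bounds the Lagrangian from above, also
where the support functions are `⊤`. -/
theorem CompositeConvex.lagrangian_le (hP : P.CompositeConvex L) {x lam c : Stack N n}
    {θ w : ∀ i, Vec (m i)} (hx : ∀ i, x i ∈ dom (P.rho i)) (hw : ∀ i, w i ∈ P.cone i)
    (hc : c ∈ boundedConsensusSet N n B) :
    P.lagrangian B x θ lam ≤ ((P.realCost x + ∑ i, ⟪θ i, P.A i (x i) - P.b i⟫_ℝ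
      - ∑ i, ⟪θ i, w i⟫_ℝ + ⟪lam, x⟫_ℝ - ⟪lam, c⟫_ℝ : ℝ) : EReal) := by
  rw [lagrangian, realCost, ← Finset.sum_add_distrib, ← Finset.sum_sub_distrib, EReal.coe_sub,
    EReal.coe_add, ereal_coe_sum]
  refine EReal.sub_le_sub (add_le_add_left (Finset.sum_le_sum fun i _ => ?_) _) (le_supportFn hc)
  rw [hP.localCost_eq (hx i), EReal.coe_sub, EReal.coe_add _ ⟪θ i, _⟫_ℝ]
  exact EReal.sub_le_sub le_rfl (le_supportFn (hw i))

theorem CompositeConvex.le_lagrangian (hP : P.CompositeConvex L) {x lam : Stack N n}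
    {θ : ∀ i, Vec (m i)} (hx : ∀ i, x i ∈ dom (P.rho i))
    (hθ : ∀ i, θ i ∈ polar (P.cone i : Set (Vec (m i))))
    (hlam : ∀ c ∈ boundedConsensusSet N n B, ⟪lam, c⟫_ℝ ≤ 0) :
    ((P.realCost x + ∑ i, ⟪θ i, P.A i (x i) - P.b i⟫_ℝ + ⟪lam, x⟫_ℝ : ℝ) : EReal)
      ≤ P.lagrangian B x θ lam := by
  rw [lagrangian, realCost, ← Finset.sum_add_distrib,
    ← sub_zero (_ + ⟪lam, x⟫_ℝ : ℝ), EReal.coe_sub, EReal.coe_add, ereal_coe_sum]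
  refine EReal.sub_le_sub (add_le_add_left (Finset.sum_le_sum fun i _ => ?_) _) (supportFn_le hlam)
  rw [hP.localCost_eq (hx i), ← sub_zero (_ + ⟪θ i, _⟫_ℝ : ℝ), EReal.coe_sub,
    EReal.coe_add _ ⟪θ i, _⟫_ℝ]
  exact EReal.sub_le_sub le_rfl (supportFn_le (hθ i))

theorem lagrangian_zero (hB : 0 ≤ B) (x : Stack N n) : P.lagrangian B x 0 0 = P.cost x := by
  have h1 : ∀ {E : Type} [NormedAddCommGroup E] [InnerProductSpace ℝ E] {S : Set E},
      (0 : E) ∈ S → supportFn S (0 : E) = 0 := fun h =>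
    le_antisymm (supportFn_le fun w _ => (inner_zero_left w).le) (by
      simpa using le_supportFn (θ := (0 : _)) h)
  have h2 : (0 : Stack N n) ∈ boundedConsensusSet N n B := ⟨0, by simpa using hB, fun _ => rfl⟩
  rw [lagrangian, h1 h2, inner_zero_left, EReal.coe_zero, add_zero, sub_zero, cost]
  refine Finset.sum_congr rfl fun i _ => ?_
  have h3 : (0 : Vec (m i)) ∈ (P.cone i : Set (Vec (m i))) := (P.cone i).zero_mem
  rw [Pi.zero_apply, h1 h3, inner_zero_left, EReal.coe_zero, add_zero, sub_zero]

/-- What the convergence analysis uses of a saddle point: `𝐱*` has finite cost, is feasible, lies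
in the consensus subspace, `θ*` lies in the polar cones, and `𝐱*` minimizes a Lagrangian in
which the support functions are bounded below by their values at points of the cones and of `C`. -/
structure IsSaddleData (P : Problem N n m) (B : ℝ) (xs : Stack N n) (θs : ∀ i, Vec (m i))
    (ls : Stack N n) : Prop where
  mem_dom : ∀ i, xs i ∈ dom (P.rho i)
  mem_polar : ∀ i, θs i ∈ polar (P.cone i : Set (Vec (m i)))
  feasible : ∀ i, P.A i (xs i) - P.b i ∈ P.cone i
  consensus : ∀ i, xs i = blockMean xs
  realCost_le : ∀ x : Stack N n, (∀ i, x i ∈ dom (P.rho i)) → ∀ z : Vec n, ‖z‖ ≤ B →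
    P.realCost xs ≤ P.realCost x + ∑ i, ⟪θs i, P.A i (x i) - P.b i⟫_ℝ + ⟪ls, x - constStack N z⟫_ℝ

/-- A real number all of whose nonnegative multiples are bounded above is nonpositive. -/
theorem nonpos_of_mul_le {a M : ℝ} (h : ∀ t : ℝ, 0 ≤ t → t * a ≤ M) : a ≤ 0 := by
  by_contra! ha
  have h0 := h 0 le_rfl
  have := h ((M + 1) / a) (by apply div_nonneg <;> linarith)
  rw [div_mul_cancel₀ _ ha.ne'] at this
  linarith

theorem IsSaddle.isSaddleData (hP : P.CompositeConvex L) (hN : 0 < N) (hB : 0 ≤ B)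
    {xs : Stack N n} {θs : ∀ i, Vec (m i)} {ls : Stack N n} (h : P.IsSaddle B xs θs ls) :
    P.IsSaddleData B xs θs ls := by
  have hC0 : (0 : Stack N n) ∈ boundedConsensusSet N n B := ⟨0, by simpa using hB, fun _ => rfl⟩
  have hK0 : ∀ i, (0 : ∀ i, Vec (m i)) i ∈ P.cone i := fun i => (P.cone i).zero_mem
  have hle : ∀ x, P.cost xs ≤ P.lagrangian B x θs ls := fun x => by
    rw [← lagrangian_zero hB]
    exact (h.1 0 0).trans (h.2 x)
  have hdom : ∀ i, xs i ∈ dom (P.rho i) := by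
    choose x0 hx0 using fun i => (hP.rho_convex i).nonempty_dom
    refine hP.mem_dom_of_sum_ne_top (ne_top_of_le_ne_top (EReal.coe_ne_top _)
      ((hle (WithLp.toLp 2 x0)).trans (hP.lagrangian_le hx0 hK0 hC0)))
  -- the saddle value is at most a real number `M`
  obtain ⟨M, hM⟩ : ∃ M : ℝ, P.lagrangian B xs θs ls ≤ M := ⟨_, hP.lagrangian_le hdom hK0 hC0⟩
  refine ⟨hdom, fun i w hw => ?_, fun i => ?_, ?_, fun x hx z hz => ?_⟩
  · refine nonpos_of_mul_le (M := ∑ i, ⟪θs i, P.A i (xs i) - P.b i⟫_ℝ + ⟪ls, xs⟫_ℝ) fun t ht => ?_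
    have hmem : ∀ j, (Pi.single i (t • w) : ∀ i, Vec (m i)) j ∈ P.cone j := by
      intro j
      by_cases hj : j = i
      · subst hj
        rw [Pi.single_eq_same]
        exact (P.cone j).smul_mem hw ht
      · rw [Pi.single_eq_of_ne hj]
        exact (P.cone j).zero_mem
    have hsum : ∑ j, ⟪θs j, (Pi.single i (t • w) : ∀ i, Vec (m i)) j⟫_ℝ = t * ⟪θs i, w⟫_ℝ := by
      rw [Finset.sum_eq_single i (fun j _ hj => by rw [Pi.single_eq_of_ne hj, inner_zero_right])
        (fun hi => absurd (Finset.mem_univ i) hi), Pi.single_eq_same, real_inner_smul_right]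
    have h1 := (hle xs).trans (hP.lagrangian_le hdom hmem hC0)
    rw [hP.cost_eq hdom, EReal.coe_le_coe_iff, inner_zero_right, hsum] at h1
    linarith
  · obtain ⟨k, hk, hpol, horth⟩ := exists_moreau_decomposition (P.cone i) (P.A i (xs i) - P.b i)
    set v := P.A i (xs i) - P.b i with hv
    have h0 : ‖v - k‖ ^ 2 ≤ 0 := by
      refine nonpos_of_mul_le (M := M - P.realCost xs) fun t ht => ?_
      have hmem : ∀ j, (Pi.single i (t • (v - k)) : ∀ i, Vec (m i)) j
          ∈ polar (P.cone j : Set (Vec (m j))) := by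
        intro j
        by_cases hj : j = i
        · subst hj
          rw [Pi.single_eq_same]
          exact smul_mem_polar hpol ht
        · rw [Pi.single_eq_of_ne hj]
          intro w _
          rw [inner_zero_left]
      have h1 := ((hP.le_lagrangian (lam := 0) (B := B) hdom hmem fun c _ =>
        (inner_zero_left c).le).trans (h.1 _ 0)).trans hM
      rw [EReal.coe_le_coe_iff, inner_zero_left,
        Finset.sum_eq_single i (fun j _ hj => by rw [Pi.single_eq_of_ne hj, inner_zero_left])
          (fun hi => absurd (Finset.mem_univ i) hi), Pi.single_eq_same, real_inner_smul_left,
        ← hv] at h1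
      have h2 : ⟪v - k, v⟫_ℝ = ‖v - k‖ ^ 2 := by
        rw [← real_inner_self_eq_norm_sq (v - k), inner_sub_right (v - k) v k, horth, sub_zero]
      rw [h2] at h1
      linarith
    have h3 : v - k = 0 := by
      rw [← norm_eq_zero]
      exact pow_eq_zero_iff two_ne_zero |>.1 (le_antisymm h0 (sq_nonneg _))
    rw [sub_eq_zero.1 h3]
    exact hk
  · have h0 : ‖consensusResidual xs‖ ^ 2 ≤ 0 := by
      refine nonpos_of_mul_le (M := M - P.realCost xs) fun t ht => ?_
      have h1 := ((hP.le_lagrangian (θ := 0) (lam := t • consensusResidual xs) (B := B) hdom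
        (fun i w _ => (inner_zero_left w).le) ?_).trans (h.1 0 _)).trans hM
      · rw [EReal.coe_le_coe_iff, real_inner_smul_left, inner_consensusResidual_self hN] at h1
        simp only [Pi.zero_apply, inner_zero_left, Finset.sum_const_zero] at h1
        linarith
      · rintro c ⟨z, -, hz⟩
        have : c = constStack N z := PiLp.ext hz
        rw [this, real_inner_smul_left, inner_consensusResidual_constStack hN, mul_zero]
    have h3 : consensusResidual xs = 0 := by
      rw [← norm_eq_zero]
      exact pow_eq_zero_iff two_ne_zero |>.1 (le_antisymm h0 (sq_nonneg _))
    intro i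
    have h4 := congrArg (fun y : Stack N n => y i) (sub_eq_zero.1 h3)
    exact h4
  · have h1 := (hle x).trans (hP.lagrangian_le hx hK0
      (⟨z, hz, fun _ => rfl⟩ : constStack N z ∈ boundedConsensusSet N n B))
    rw [hP.cost_eq hdom, EReal.coe_le_coe_iff] at h1
    simp only [Pi.zero_apply, inner_zero_right, Finset.sum_const_zero] at h1
    rw [inner_sub_right]
    linarith

end Problem

end SaddlePoint

/-! ### Inexact averaging -/

section ApproximateAveraging

variable {N n : ℕ} {G : ℕ → SimpleGraph (Fin N)} {V : ℕ → Matrix (Fin N) (Fin N) ℝ} {ζ : ℝ} {T : ℕ}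
  {B : ℝ}

/-- After `q` consensus steps every node is close to the projection of the exact average. -/
theorem InfoExchange.norm_sub_le_of_isApproxAverage (hV : InfoExchange G V ζ T) (hN : 2 ≤ N)
    {s q : ℕ} {z r : Stack N n} (h : IsApproxAverage V B s q z r) {Z : ℝ} (hz : ∀ i, ‖z i‖ ≤ Z)
    {c : Vec n} (hc : IsProjection (Metric.closedBall (0 : Vec n) B) (blockMean z) c) (i : Fin N) :
    ‖r i - c‖ ≤ Gam N T ζ * alph N T ζ ^ q * (N * Z) := by
  refine ((h i).norm_sub_le (convex_closedBall _ _) hc).trans ?_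
  have h1 : ∑ j, mixing V s q i j • z j - blockMean z
      = ∑ j, (mixing V s q i j - 1 / (N : ℝ)) • z j := by
    simp only [sub_smul, Finset.sum_sub_distrib, blockMean, Finset.smul_sum]
  have hnn : 0 ≤ Gam N T ζ * alph N T ζ ^ q :=
    mul_nonneg (hV.Gam_pos hN).le (pow_nonneg (hV.alph_mem hN).1.le q)
  rw [h1]
  calc ‖∑ j, (mixing V s q i j - 1 / (N : ℝ)) • z j‖
      ≤ ∑ _j : Fin N, Gam N T ζ * alph N T ζ ^ q * Z := by
        refine (norm_sum_le _ _).trans (Finset.sum_le_sum fun j _ => ?_)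
        rw [norm_smul, Real.norm_eq_abs]
        exact mul_le_mul (hV.abs_mixing_sub_le hN s q i j) (hz j) (norm_nonneg _) hnn
    _ = Gam N T ζ * alph N T ζ ^ q * (N * Z) := by
        rw [Finset.sum_const, Finset.card_univ, Fintype.card_fin, nsmul_eq_mul]
        ring

/-- The effect of replacing the projection of `z` onto `C` by a vector `r` at distance at most `ε`
in the update `μ' = γ (z - r)` of the consensus multiplier. -/
theorem inner_add_inner_le_of_norm_sub_le (hN : 0 < N) (hB : 0 ≤ B) {γ ε : ℝ} (hγ : 0 < γ)
    {z r μ' l : Stack N n} {c y : Vec n}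
    (hc : IsProjection (Metric.closedBall (0 : Vec n) B) (blockMean z) c) (hy : ‖y‖ ≤ B)
    (hr : ‖r - constStack N c‖ ≤ ε) (hμ : μ' = γ • (z - r))
    (hl : ∀ v : Vec n, ⟪l, constStack N v⟫_ℝ = 0) :
    ⟪constStack N y, μ'⟫_ℝ + ⟪r, l - μ'⟫_ℝ ≤ ε * (‖l‖ + 2 * γ * (√(N : ℝ) * B) + ‖μ'‖) := by
  set C := constStack N c with hC
  set Y := constStack N y with hY
  have hε : 0 ≤ ε := (norm_nonneg _).trans hr
  have hc' : ‖c‖ ≤ B := by simpa using hc.1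
  have h1 : ⟪Y - C, z - C⟫_ℝ ≤ 0 := by
    have h := hc.inner_le_zero (convex_closedBall _ _) (v := y) (by simpa using hy)
    have h2 : ⟪Y - C, z - C⟫_ℝ = N * ⟪blockMean z - c, y - c⟫_ℝ := by
      rw [PiLp.inner_apply]
      simp only [PiLp.sub_apply, hC, hY, constStack_apply]
      rw [← inner_sum, Finset.sum_sub_distrib, sum_eq_smul_blockMean hN, Finset.sum_const,
        Finset.card_univ, Fintype.card_fin, ← Nat.cast_smul_eq_nsmul ℝ, ← smul_sub,
        real_inner_smul_right, real_inner_comm]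
    rw [h2]
    exact mul_nonpos_of_nonneg_of_nonpos (Nat.cast_nonneg N) h
  have h2 : ‖Y - C‖ ≤ 2 * (√(N : ℝ) * B) := by
    refine (norm_sub_le _ _).trans ?_
    have := norm_stack_le (x := Y) hB fun _ => hy
    have := norm_stack_le (x := C) hB fun _ => hc'
    linarith
  have h3 : ⟪r - C, l⟫_ℝ ≤ ε * ‖l‖ :=
    (real_inner_le_norm _ _).trans (mul_le_mul_of_nonneg_right hr (norm_nonneg _))
  have h4 : -⟪r - C, μ'⟫_ℝ ≤ ε * ‖μ'‖ := by
    rw [← inner_neg_left]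
    refine (real_inner_le_norm _ _).trans ?_
    rw [norm_neg]
    exact mul_le_mul_of_nonneg_right hr (norm_nonneg _)
  have h5 : -⟪Y - C, r - C⟫_ℝ ≤ 2 * (√(N : ℝ) * B) * ε := by
    rw [← inner_neg_right]
    refine (real_inner_le_norm _ _).trans ?_
    rw [norm_neg]
    exact mul_le_mul h2 hr (norm_nonneg _) (by positivity)
  -- `Y - r = (Y - C) - (r - C)`, `μ' = γ (z - C) - γ (r - C)`, and `l` is orthogonal to `C`
  have h6 : ⟪Y, μ'⟫_ℝ + ⟪r, l - μ'⟫_ℝ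
      = γ * ⟪Y - C, z - C⟫_ℝ + γ * -⟪Y - C, r - C⟫_ℝ + -⟪r - C, μ'⟫_ℝ + ⟪r - C, l⟫_ℝ := by
    have h7 : ⟪C, l⟫_ℝ = 0 := by rw [real_inner_comm]; exact hl c
    have h8 : μ' = γ • (z - C) - γ • (r - C) := by rw [hμ]; module
    have h9 : ⟪Y - C, μ'⟫_ℝ = γ * ⟪Y - C, z - C⟫_ℝ + γ * -⟪Y - C, r - C⟫_ℝ := by
      rw [h8, inner_sub_right, real_inner_smul_right, real_inner_smul_right]
      ring
    rw [← h9]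
    simp only [inner_sub_left, inner_sub_right, h7]
    ring
  rw [h6]
  have := mul_le_mul_of_nonneg_left h1 hγ.le
  have := mul_le_mul_of_nonneg_left h5 hγ.le
  linarith

end ApproximateAveraging

/-! ### One iteration of the algorithm -/

section Iteration

variable {N n : ℕ} {m : Fin N → ℕ} {P : Problem N n m} {L : Fin N → ℝ≥0} {B : ℝ}
  {G : ℕ → SimpleGraph (Fin N)} {V : ℕ → Matrix (Fin N) (Fin N) ℝ} {ζ : ℝ} {T : ℕ} {q : ℕ → ℕ}
  {τ κ : Fin N → ℝ} {γ : ℝ} {x μ : ℕ → Stack N n} {θ : ℕ → ∀ i, Vec (m i)}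

theorem IsDPDAD.mem_dom (h : IsDPDAD P B V q τ κ γ x μ θ) (hP : P.CompositeConvex L)
    (hτ : ∀ i, 0 < τ i) (hx0 : ∀ i, x 0 i ∈ dom (P.rho i)) (k : ℕ) (i : Fin N) :
    x k i ∈ dom (P.rho i) := by
  cases k with
  | zero => exact hx0 i
  | succ k => exact (h.x_step k i).mem_dom (hP.rho_convex i) (hτ i)

theorem norm_two_smul_sub_le {E : Type*} [NormedAddCommGroup E] [NormedSpace ℝ E] {u v : E} {b : ℝ}
    (hu : ‖u‖ ≤ b) (hv : ‖v‖ ≤ b) : ‖(2 : ℝ) • u - v‖ ≤ 3 * b := by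
  have h1 := norm_sub_le ((2 : ℝ) • u) v
  rw [norm_smul, Real.norm_ofNat] at h1
  linarith

/-- The consensus multipliers grow at most linearly. -/
theorem IsDPDAD.norm_mu_le (h : IsDPDAD P B V q τ κ γ x μ θ) (hγ : 0 < γ)
    (hx : ∀ k i, ‖x k i‖ ≤ B) (k : ℕ) (i : Fin N) : ‖μ k i‖ ≤ 4 * γ * B * k := by
  induction k with
  | zero => simp [h.mu_zero]
  | succ k ih =>
    obtain ⟨r, hr, hμ⟩ := h.mu_step k
    have hri : ‖r i‖ ≤ B := by simpa using (hr i).1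
    have h1 : μ (k + 1) i = μ k i + (γ • ((2 : ℝ) • x (k + 1) i - x k i) - γ • r i) := by
      rw [hμ]
      simp only [PiLp.add_apply, PiLp.sub_apply, PiLp.smul_apply]
      abel
    rw [h1]
    refine (norm_add_le _ _).trans ?_
    have h2 := norm_sub_le (γ • ((2 : ℝ) • x (k + 1) i - x k i)) (γ • r i)
    rw [norm_smul, norm_smul, Real.norm_of_nonneg hγ.le] at h2
    have h3 := mul_le_mul_of_nonneg_left (norm_two_smul_sub_le (hx (k + 1) i) (hx k i)) hγ.le
    have h4 := mul_le_mul_of_nonneg_left hri hγ.le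
    push_cast
    linarith

/-- The error that inexact averaging contributes to the one-iteration inequality of iteration `k`,
for a multiplier of norm at most `Λ`. It is the product of the distance
`√N · Γ α^{q_k} · N · 4 B k` between `r` and the exact projection and of
`Λ + 2 γ √N B + 4 γ √N B k`, the last term of which bounds `‖μ^k‖`. -/
noncomputable def averagingError (N T : ℕ) (ζ B γ : ℝ) (q : ℕ → ℕ) (Λ : ℝ) (k : ℕ) : ℝ :=
  8 * (N : ℝ) ^ 2 * B ^ 2 * Gam N T ζ * (alph N T ζ ^ q k *
    (2 * γ * (k : ℝ) ^ 2 + (γ + Λ / (2 * (√(N : ℝ) * B))) * (k : ℝ)))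

/-- The Lyapunov function of the whole network. -/
noncomputable def totalPotential (P : Problem N n m) (τ κ : Fin N → ℝ) (γ : ℝ) (xs l : Stack N n)
    (ϑ : ∀ i, Vec (m i)) (x μ : Stack N n) (θ : ∀ i, Vec (m i)) : ℝ :=
  ∑ i, potential (P.A i) (τ i) (κ i) γ (xs i) (ϑ i) (l i) (x i) (μ i) (θ i)

/-- The one-iteration inequality of the algorithm. -/
theorem IsDPDAD.step (h : IsDPDAD P B V q τ κ γ x μ θ) (hN : 2 ≤ N) (hP : P.CompositeConvex L)
    (hB : 0 < B) (hV : InfoExchange G V ζ T) (hτ : ∀ i, 0 < τ i) (hκ : ∀ i, 0 < κ i) (hγ : 0 < γ)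
    (hstep : ∀ i, ‖P.A i‖ ^ 2 ≤ (1 / τ i - (L i : ℝ) - γ) * (1 / κ i))
    (hx : ∀ k i, x k i ∈ dom (P.rho i)) (hxB : ∀ k i, ‖x k i‖ ≤ B)
    {y : Vec n} (hy : ∀ i, y ∈ dom (P.rho i)) (hyB : ‖y‖ ≤ B)
    (hfeas : ∀ i, P.A i y - P.b i ∈ P.cone i) {l : Stack N n}
    (hl : ∀ v : Vec n, ⟪l, constStack N v⟫_ℝ = 0) {ϑ : ∀ i, Vec (m i)}
    (hϑ : ∀ i, ϑ i ∈ polar (P.cone i : Set (Vec (m i)))) (k : ℕ) :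
    P.realCost (x (k + 1)) - P.realCost (constStack N y)
        + ∑ i, ⟪ϑ i, P.A i (x (k + 1) i) - P.b i⟫_ℝ + ⟪l, x (k + 1)⟫_ℝ ≤
      totalPotential P τ κ γ (constStack N y) l ϑ (x k) (μ k) (θ k)
        - totalPotential P τ κ γ (constStack N y) l ϑ (x (k + 1)) (μ (k + 1)) (θ (k + 1))
        + averagingError N T ζ B γ q ‖l‖ (k + 1) := by
  obtain ⟨r, hr, hμ⟩ := h.mu_step k
  have hgrad : ∀ i, ∀ u ∈ dom (P.rho i), HasGradientAt (P.f i) (gradient (P.f i) u) u := by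
    intro i u hu
    obtain ⟨U, hU, hsub, hd⟩ := hP.f_diff i
    exact ((hd u (hsub hu)).differentiableAt (hU.mem_nhds (hsub hu))).hasGradientAt
  have hnode := fun i => node_step (P.A i) (P.b i) (hP.rho_convex i) (hP.f_convex i) (hgrad i)
    (hP.grad_lipschitz i) (hτ i) (hκ i) hγ (hstep i) (convex_polar _) (l := l i) (μ' := μ (k + 1) i)
    (r := r i) (hx k i) (h.x_step k i) (by rw [hμ]; rfl) (h.theta_step k i) (hy i) (hϑ i)
    ((h.theta_step k i).1 _ (hfeas i))
  have hsum := Finset.sum_le_sum fun i (_ : i ∈ Finset.univ) => hnode i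
  simp only [Finset.sum_add_distrib, Finset.sum_sub_distrib] at hsum
  -- the averaging error of this iteration
  set z : Stack N n := (1 / γ) • μ k + (2 : ℝ) • x (k + 1) - x k with hz
  have hzB : ∀ i, ‖z i‖ ≤ 4 * B * (k + 1) := by
    intro i
    have h1 : z i = (1 / γ) • μ k i + ((2 : ℝ) • x (k + 1) i - x k i) := by
      rw [hz]
      simp only [PiLp.add_apply, PiLp.sub_apply, PiLp.smul_apply]
      abel
    rw [h1]
    refine (norm_add_le _ _).trans ?_
    have h2 := norm_two_smul_sub_le (hxB (k + 1) i) (hxB k i)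
    have h3 : ‖(1 / γ) • μ k i‖ ≤ 4 * B * k := by
      rw [norm_smul, Real.norm_of_nonneg (by positivity), one_div, inv_mul_le_iff₀ hγ]
      have := h.norm_mu_le hγ hxB k i
      linarith
    linarith
  obtain ⟨c, hc⟩ := exists_isProjection (S := Metric.closedBall (0 : Vec n) B)
    ⟨0, by simpa using hB.le⟩ Metric.isClosed_closedBall (convex_closedBall _ _) (blockMean z)
  set ε := √(N : ℝ) * (Gam N T ζ * alph N T ζ ^ q (k + 1) * (N * (4 * B * (k + 1)))) with hε
  have hG := hV.Gam_pos hN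
  have hα := (hV.alph_mem hN).1
  have hrc : ‖r - constStack N c‖ ≤ ε :=
    norm_stack_le (by positivity) fun i => hV.norm_sub_le_of_isApproxAverage hN hr hzB hc i
  have hμz : μ (k + 1) = γ • (z - r) := by
    have e : γ • (1 / γ) • μ k = μ k := by
      rw [smul_smul, mul_one_div_cancel hγ.ne', one_smul]
    rw [hμ, hz]
    nth_rewrite 1 [← e]
    module
  have herr := inner_add_inner_le_of_norm_sub_le (by omega) hB.le hγ hc hyB hrc hμz hl
  have hμB : ‖μ (k + 1)‖ ≤ √(N : ℝ) * (4 * γ * B * (k + 1)) := by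
    refine norm_stack_le (by positivity) fun i => ?_
    simpa using h.norm_mu_le hγ hxB (k + 1) i
  have hN0 : (0 : ℝ) < N := by exact_mod_cast (by omega : 0 < N)
  have hs : 0 < √(N : ℝ) := Real.sqrt_pos.2 hN0
  have hEq : ε * (‖l‖ + 2 * γ * (√(N : ℝ) * B) + √(N : ℝ) * (4 * γ * B * (k + 1)))
      = averagingError N T ζ B γ q ‖l‖ (k + 1) := by
    have hsq : (N : ℝ) = √(N : ℝ) ^ 2 := (Real.sq_sqrt hN0.le).symm
    rw [hε, averagingError]
    generalize Gam N T ζ = g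
    generalize alph N T ζ ^ q (k + 1) = a
    generalize √(N : ℝ) = s at *
    rw [hsq]
    push_cast
    field_simp
    ring
  have herr' : ε * (‖l‖ + 2 * γ * (√(N : ℝ) * B) + ‖μ (k + 1)‖)
      ≤ averagingError N T ζ B γ q ‖l‖ (k + 1) := by
    rw [← hEq]
    have : 0 ≤ ε := (norm_nonneg _).trans hrc
    gcongr
  have e1 : ⟪l, x (k + 1)⟫_ℝ = ∑ i, ⟪l i, x (k + 1) i⟫_ℝ := PiLp.inner_apply _ _
  have e2 : ⟪constStack N y, μ (k + 1)⟫_ℝ = ∑ i, ⟪y, μ (k + 1) i⟫_ℝ := PiLp.inner_apply _ _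
  have e3 : ⟪r, l - μ (k + 1)⟫_ℝ = ∑ i, ⟪r i, l i - μ (k + 1) i⟫_ℝ := PiLp.inner_apply _ _
  rw [e2, e3] at herr
  rw [e1]
  unfold Problem.realCost totalPotential
  simp only [constStack_apply, Finset.sum_add_distrib]
  linarith

end Iteration

/-! ### Ergodic averages -/

section Ergodic

variable {N n : ℕ} {m : Fin N → ℕ} {P : Problem N n m} {L : Fin N → ℝ≥0} {B : ℝ}
  {G : ℕ → SimpleGraph (Fin N)} {V : ℕ → Matrix (Fin N) (Fin N) ℝ} {ζ : ℝ} {T : ℕ} {q : ℕ → ℕ}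
  {τ κ : Fin N → ℝ} {γ : ℝ} {x μ : ℕ → Stack N n} {θ : ℕ → ∀ i, Vec (m i)}

namespace Problem

theorem CompositeConvex.convexOn_realCost (hP : P.CompositeConvex L) :
    ConvexOn ℝ {u : Stack N n | ∀ i, u i ∈ dom (P.rho i)} P.realCost := by
  refine ⟨fun u hu v hv s t hs ht hst i => (hP.rho_convex i).convexOn.1 (hu i) (hv i) hs ht hst,
    fun u hu v hv s t hs ht hst => ?_⟩
  simp only [realCost, smul_eq_mul, Finset.mul_sum, ← Finset.sum_add_distrib, PiLp.add_apply,
    PiLp.smul_apply]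
  refine Finset.sum_le_sum fun i _ => ?_
  have h1 := (hP.rho_convex i).convexOn.2 (hu i) (hv i) hs ht hst
  have h2 := (hP.f_convex i).2 (Set.mem_univ (u i)) (Set.mem_univ (v i)) hs ht hst
  simp only [smul_eq_mul] at h1 h2
  linarith

/-- The Lagrangian with fixed multipliers, without the support function terms, is convex. -/
theorem CompositeConvex.convexOn_linearized (hP : P.CompositeConvex L) (a : ℝ) (l : Stack N n)
    (ϑ : ∀ i, Vec (m i)) :
    ConvexOn ℝ {u : Stack N n | ∀ i, u i ∈ dom (P.rho i)} fun u =>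
      P.realCost u - a + ∑ i, ⟪ϑ i, P.A i (u i) - P.b i⟫_ℝ + ⟪l, u⟫_ℝ := by
  refine ⟨hP.convexOn_realCost.1, fun u hu v hv s t hs ht hst => ?_⟩
  have h1 := hP.convexOn_realCost.2 hu hv hs ht hst
  have h2 : ∑ i, ⟪ϑ i, P.A i ((s • u + t • v) i) - P.b i⟫_ℝ
      = s * ∑ i, ⟪ϑ i, P.A i (u i) - P.b i⟫_ℝ + t * ∑ i, ⟪ϑ i, P.A i (v i) - P.b i⟫_ℝ := by
    rw [Finset.mul_sum, Finset.mul_sum, ← Finset.sum_add_distrib]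
    refine Finset.sum_congr rfl fun i _ => ?_
    rw [PiLp.add_apply, PiLp.smul_apply, PiLp.smul_apply, map_add, map_smul, map_smul,
      inner_sub_right, inner_sub_right, inner_sub_right, inner_add_right, real_inner_smul_right,
      real_inner_smul_right]
    linear_combination ⟪ϑ i, P.b i⟫_ℝ * hst
  simp only [smul_eq_mul] at h1 ⊢
  rw [h2, inner_add_right, real_inner_smul_right, real_inner_smul_right]
  have h3 : a = s * a + t * a := by rw [← add_mul, hst, one_mul]
  linarith

end Problem

theorem ergodic_eq_sum (x : ℕ → Stack N n) (K : ℕ) :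
    ergodic x K = ∑ k ∈ Finset.Icc 1 K, (1 / (K : ℝ)) • x k := by
  rw [ergodic, Finset.smul_sum]

theorem sum_Icc_one_div {K : ℕ} (hK : 1 ≤ K) : ∑ _k ∈ Finset.Icc 1 K, 1 / (K : ℝ) = 1 := by
  have : (K : ℝ) ≠ 0 := by exact_mod_cast (by omega : K ≠ 0)
  rw [Finset.sum_const, Nat.card_Icc, Nat.add_sub_cancel, nsmul_eq_mul, mul_one_div_cancel this]

theorem ergodic_mem_dom (hP : P.CompositeConvex L) (hx : ∀ k i, x k i ∈ dom (P.rho i)) {K : ℕ}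
    (hK : 1 ≤ K) (i : Fin N) : ergodic x K i ∈ dom (P.rho i) := by
  rw [ergodic_eq_sum]
  exact hP.convexOn_realCost.1.sum_mem (fun k _ => by positivity) (sum_Icc_one_div hK)
    (fun k _ => hx k) i

/-- Summation of the one-iteration inequalities, and Jensen's inequality. -/
theorem IsDPDAD.mul_ergodic_le (h : IsDPDAD P B V q τ κ γ x μ θ) (hN : 2 ≤ N)
    (hP : P.CompositeConvex L) (hB : 0 < B) (hV : InfoExchange G V ζ T) (hτ : ∀ i, 0 < τ i)
    (hκ : ∀ i, 0 < κ i) (hγ : 0 < γ)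
    (hstep : ∀ i, ‖P.A i‖ ^ 2 ≤ (1 / τ i - (L i : ℝ) - γ) * (1 / κ i))
    (hx : ∀ k i, x k i ∈ dom (P.rho i)) (hxB : ∀ k i, ‖x k i‖ ≤ B)
    {y : Vec n} (hy : ∀ i, y ∈ dom (P.rho i)) (hyB : ‖y‖ ≤ B)
    (hfeas : ∀ i, P.A i y - P.b i ∈ P.cone i) {l : Stack N n}
    (hl : ∀ v : Vec n, ⟪l, constStack N v⟫_ℝ = 0) {ϑ : ∀ i, Vec (m i)}
    (hϑ : ∀ i, ϑ i ∈ polar (P.cone i : Set (Vec (m i)))) {K : ℕ} (hK : 1 ≤ K) :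
    K * (P.realCost (ergodic x K) - P.realCost (constStack N y)
        + ∑ i, ⟪ϑ i, P.A i (ergodic x K i) - P.b i⟫_ℝ + ⟪l, ergodic x K⟫_ℝ) ≤
      totalPotential P τ κ γ (constStack N y) l ϑ (x 0) (μ 0) (θ 0)
        + ∑ k ∈ Finset.Icc 1 K, averagingError N T ζ B γ q ‖l‖ k := by
  have hsum : ∀ K : ℕ, ∑ k ∈ Finset.Icc 1 K, (P.realCost (x k) - P.realCost (constStack N y)
        + ∑ i, ⟪ϑ i, P.A i (x k i) - P.b i⟫_ℝ + ⟪l, x k⟫_ℝ) ≤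
      totalPotential P τ κ γ (constStack N y) l ϑ (x 0) (μ 0) (θ 0)
        - totalPotential P τ κ γ (constStack N y) l ϑ (x K) (μ K) (θ K)
        + ∑ k ∈ Finset.Icc 1 K, averagingError N T ζ B γ q ‖l‖ k := by
    intro K
    induction K with
    | zero => simp
    | succ K ih =>
      rw [Finset.sum_Icc_succ_top (by omega), Finset.sum_Icc_succ_top (by omega)]
      have := h.step hN hP hB hV hτ hκ hγ hstep hx hxB hy hyB hfeas hl hϑ K
      linarith
  have hpot : 0 ≤ totalPotential P τ κ γ (constStack N y) l ϑ (x K) (μ K) (θ K) :=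
    Finset.sum_nonneg fun i _ => potential_nonneg _ (hκ i) hγ (hstep i) _ _ _ _ _ _
  have hjensen := (hP.convexOn_linearized (P.realCost (constStack N y)) l ϑ).map_sum_le
    (t := Finset.Icc 1 K) (w := fun _ => 1 / (K : ℝ)) (p := x) (fun k _ => by positivity)
    (sum_Icc_one_div hK) (fun k _ => hx k)
  rw [← ergodic_eq_sum] at hjensen
  have hK0 : (0 : ℝ) < K := by exact_mod_cast hK
  have h1 := mul_le_mul_of_nonneg_left hjensen hK0.le
  simp only [smul_eq_mul] at h1
  rw [← Finset.mul_sum, ← mul_assoc, mul_one_div_cancel hK0.ne', one_mul] at h1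
  linarith [hsum K]

/-- For `v = 0` the quotient is `M / 0 = 0`, and the bound still holds. -/
theorem norm_div_smul_le {E : Type*} [NormedAddCommGroup E] [NormedSpace ℝ E] {M : ℝ} (hM : 0 ≤ M)
    (v : E) : ‖(M / ‖v‖) • v‖ ≤ M := by
  rw [norm_smul, Real.norm_of_nonneg (by positivity)]
  rcases eq_or_ne ‖v‖ 0 with h | h
  · rw [h, mul_zero]; exact hM
  · rw [div_mul_cancel₀ _ h]

theorem div_norm_mul_sq {E : Type*} [NormedAddCommGroup E] (M : ℝ) (v : E) :
    M / ‖v‖ * ‖v‖ ^ 2 = M * ‖v‖ := by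
  rcases eq_or_ne ‖v‖ 0 with h | h
  · rw [h]; ring
  · field_simp

theorem averagingError_mono (hN : 2 ≤ N) (hB : 0 < B) (hV : InfoExchange G V ζ T) {Λ M : ℝ}
    (hΛ : Λ ≤ M) (k : ℕ) : averagingError N T ζ B γ q Λ k ≤ averagingError N T ζ B γ q M k := by
  have hG := hV.Gam_pos hN
  have hα := (hV.alph_mem hN).1
  unfold averagingError
  gcongr

/-- The bound on the weighted residuals of the ergodic average. The multipliers of
`mul_ergodic_le` are chosen along the residuals, with norms `M` and `Mθ i`. -/
theorem IsDPDAD.mul_residual_le (h : IsDPDAD P B V q τ κ γ x μ θ) (hN : 2 ≤ N)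
    (hP : P.CompositeConvex L) (hB : 0 < B) (hV : InfoExchange G V ζ T) (hτ : ∀ i, 0 < τ i)
    (hκ : ∀ i, 0 < κ i) (hγ : 0 < γ)
    (hstep : ∀ i, ‖P.A i‖ ^ 2 ≤ (1 / τ i - (L i : ℝ) - γ) * (1 / κ i))
    (hx : ∀ k i, x k i ∈ dom (P.rho i)) (hxB : ∀ k i, ‖x k i‖ ≤ B) (hθ0 : ∀ i, θ 0 i = 0)
    {y : Vec n} (hy : ∀ i, y ∈ dom (P.rho i)) (hyB : ‖y‖ ≤ B)
    (hfeas : ∀ i, P.A i y - P.b i ∈ P.cone i) {M : ℝ} (hM : 0 ≤ M) {Mθ : Fin N → ℝ}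
    (hMθ : ∀ i, 0 ≤ Mθ i) {K : ℕ} (hK : 1 ≤ K) :
    K * (P.realCost (ergodic x K) - P.realCost (constStack N y)
        + ∑ i, Mθ i * Metric.infDist (P.A i (ergodic x K i) - P.b i)
            (P.cone i : Set (Vec (m i)))
        + M * ‖consensusResidual (ergodic x K)‖) ≤
      ∑ i, (1 / τ i * ‖y - x 0 i‖ ^ 2 + 1 / κ i * Mθ i ^ 2) + 1 / (2 * γ) * M ^ 2
        + M * ‖x 0 - constStack N y‖
        + ∑ k ∈ Finset.Icc 1 K, averagingError N T ζ B γ q M k := by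
  have hN0 : 0 < N := by omega
  choose k hk hpol horth using fun i =>
    exists_moreau_decomposition (P.cone i) (P.A i (ergodic x K i) - P.b i)
  set w : ∀ i, Vec (m i) := fun i => P.A i (ergodic x K i) - P.b i with hw
  set ϑ : ∀ i, Vec (m i) := fun i => (Mθ i / ‖w i - k i‖) • (w i - k i) with hϑ
  set u := consensusResidual (ergodic x K) with hu
  set l : Stack N n := (M / ‖u‖) • u with hl
  have hlM : ‖l‖ ≤ M := norm_div_smul_le hM u
  have h1 := h.mul_ergodic_le hN hP hB hV hτ hκ hγ hstep hx hxB hy hyB hfeas (l := l) (ϑ := ϑ)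
    (fun v => by rw [hl, real_inner_smul_left, inner_consensusResidual_constStack hN0, mul_zero])
    (fun i => smul_mem_polar (hpol i) (div_nonneg (hMθ i) (norm_nonneg _))) hK
  have h2 : ⟪l, ergodic x K⟫_ℝ = M * ‖u‖ := by
    rw [hl, real_inner_smul_left, inner_consensusResidual_self hN0, div_norm_mul_sq]
  have h3 : ∑ i, Mθ i * Metric.infDist (w i) (P.cone i : Set (Vec (m i))) ≤ ∑ i, ⟪ϑ i, w i⟫_ℝ := by
    refine Finset.sum_le_sum fun i _ => ?_
    have h4 : ⟪w i - k i, w i⟫_ℝ = ‖w i - k i‖ ^ 2 := by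
      rw [← real_inner_self_eq_norm_sq (w i - k i), inner_sub_right (w i - k i) (w i) (k i),
        horth i, sub_zero]
    rw [hϑ, real_inner_smul_left, h4, div_norm_mul_sq, ← dist_eq_norm]
    exact mul_le_mul_of_nonneg_left (Metric.infDist_le_dist_of_mem (hk i)) (hMθ i)
  have h5 : totalPotential P τ κ γ (constStack N y) l ϑ (x 0) (μ 0) (θ 0) ≤
      ∑ i, (1 / τ i * ‖y - x 0 i‖ ^ 2 + 1 / κ i * Mθ i ^ 2) + 1 / (2 * γ) * M ^ 2
        + M * ‖x 0 - constStack N y‖ := by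
    have h6 : totalPotential P τ κ γ (constStack N y) l ϑ (x 0) (μ 0) (θ 0) ≤
        ∑ i, (1 / τ i * ‖y - x 0 i‖ ^ 2 + 1 / κ i * Mθ i ^ 2)
          + (1 / (2 * γ) * ‖l‖ ^ 2 + ⟪x 0 - constStack N y, l⟫_ℝ) := by
      rw [PiLp.norm_sq_eq_of_L2, PiLp.inner_apply, Finset.mul_sum, ← Finset.sum_add_distrib,
        ← Finset.sum_add_distrib]
      refine Finset.sum_le_sum fun i _ => ?_
      rw [h.mu_zero, hθ0 i]
      refine (potential_zero_le _ (hκ i) hγ (hstep i) _ _ _ _).trans ?_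
      have h7 : ‖ϑ i‖ ^ 2 ≤ Mθ i ^ 2 :=
        pow_le_pow_left₀ (norm_nonneg _) (norm_div_smul_le (hMθ i) _) 2
      have h8 := mul_le_mul_of_nonneg_left h7 (one_div_pos.2 (hκ i)).le
      rw [PiLp.sub_apply, constStack_apply]
      linarith
    have h9 : ⟪x 0 - constStack N y, l⟫_ℝ ≤ M * ‖x 0 - constStack N y‖ := by
      refine (real_inner_le_norm _ _).trans ?_
      rw [mul_comm]
      exact mul_le_mul_of_nonneg_right hlM (norm_nonneg _)
    have h10 : 1 / (2 * γ) * ‖l‖ ^ 2 ≤ 1 / (2 * γ) * M ^ 2 := by gcongr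
    linarith
  have h11 : ∑ k ∈ Finset.Icc 1 K, averagingError N T ζ B γ q ‖l‖ k
      ≤ ∑ k ∈ Finset.Icc 1 K, averagingError N T ζ B γ q M k :=
    Finset.sum_le_sum fun k _ => averagingError_mono hN hB hV hlM k
  rw [h2] at h1
  have hK0 : (0 : ℝ) ≤ K := Nat.cast_nonneg K
  refine le_trans (mul_le_mul_of_nonneg_left ?_ hK0) (h1.trans (add_le_add h5 h11))
  linarith

/-- The saddle point property bounds the cost from below in terms of the infeasibility. -/
theorem Problem.IsSaddleData.realCost_sub_le {xs ls : Stack N n} {θs : ∀ i, Vec (m i)}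
    (hs : P.IsSaddleData B xs θs ls) (hN : 0 < N) {u : Stack N n}
    (hu : ∀ i, u i ∈ dom (P.rho i)) (huB : ∀ i, ‖u i‖ ≤ B) :
    P.realCost xs - P.realCost u ≤
      ∑ i, ‖θs i‖ * Metric.infDist (P.A i (u i) - P.b i) (P.cone i : Set (Vec (m i)))
        + ‖ls‖ * ‖consensusResidual u‖ := by
  have h1 := hs.realCost_le u hu (blockMean u) (norm_blockMean_le hN huB)
  have h2 := real_inner_le_norm ls (u - constStack N (blockMean u))
  have h3 : ∑ i, ⟪θs i, P.A i (u i) - P.b i⟫_ℝ ≤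
      ∑ i, ‖θs i‖ * Metric.infDist (P.A i (u i) - P.b i) (P.cone i : Set (Vec (m i))) := by
    refine Finset.sum_le_sum fun i _ => ?_
    obtain ⟨k, hk, hd⟩ := (P.cone i).isClosed.exists_infDist_eq_dist ⟨0, (P.cone i).zero_mem⟩
      (P.A i (u i) - P.b i)
    rw [hd, dist_eq_norm]
    have h4 := hs.mem_polar i k hk
    have h5 := real_inner_le_norm (θs i) (P.A i (u i) - P.b i - k)
    rw [inner_sub_right] at h5
    linarith
  rw [consensusResidual]
  linarith

end Ergodic

/-! ### Summability of the averaging errors and communication counts -/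

section Rates

variable {N : ℕ} {G : ℕ → SimpleGraph (Fin N)} {V : ℕ → Matrix (Fin N) (Fin N) ℝ} {ζ : ℝ} {T : ℕ}
  {q : ℕ → ℕ} {s : ℝ}

theorem rpow_sub_one_le_of_round
    (hq : ∀ k : ℕ, 1 ≤ k → q k = ⌊(k : ℝ) ^ s⌋₊ ∨ q k = ⌈(k : ℝ) ^ s⌉₊) {k : ℕ} (hk : 1 ≤ k) :
    (k : ℝ) ^ s - 1 ≤ q k := by
  rcases hq k hk with h | h <;> rw [h]
  · linarith [Nat.lt_floor_add_one ((k : ℝ) ^ s)]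
  · linarith [Nat.le_ceil ((k : ℝ) ^ s)]

theorem le_rpow_add_one_of_round
    (hq : ∀ k : ℕ, 1 ≤ k → q k = ⌊(k : ℝ) ^ s⌋₊ ∨ q k = ⌈(k : ℝ) ^ s⌉₊) {k : ℕ} (hk : 1 ≤ k) :
    (q k : ℝ) ≤ (k : ℝ) ^ s + 1 := by
  have h0 : 0 ≤ (k : ℝ) ^ s := by positivity
  rcases hq k hk with h | h <;> rw [h]
  · linarith [Nat.floor_le h0]
  · linarith [Nat.ceil_lt_add_one h0]

/-- The factors `a ^ q k` decay like `exp (-c k ^ s)`, faster than every power of `k`. -/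
theorem summable_pow_mul_sq (hs : 0 < s)
    (hq : ∀ k : ℕ, 1 ≤ k → q k = ⌊(k : ℝ) ^ s⌋₊ ∨ q k = ⌈(k : ℝ) ^ s⌉₊) {a : ℝ}
    (ha : a ∈ Set.Ioo (0 : ℝ) 1) : Summable fun k : ℕ => a ^ q k * (k : ℝ) ^ 2 := by
  have hb : 0 < -Real.log a := neg_pos.2 (Real.log_neg ha.1 ha.2)
  have hlim : Tendsto (fun k : ℕ => (k : ℝ) ^ (4 : ℝ) * Real.exp (-(-Real.log a) * (k : ℝ) ^ s))
      atTop (𝓝 0) := by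
    have h1 := (tendsto_rpow_mul_exp_neg_mul_atTop_nhds_zero (4 / s) (-Real.log a) hb).comp
      ((tendsto_rpow_atTop hs).comp tendsto_natCast_atTop_atTop)
    refine h1.congr fun k => ?_
    simp only [Function.comp_apply]
    rw [← Real.rpow_mul (Nat.cast_nonneg k), mul_div_cancel₀ _ hs.ne']
  have hle : ∀ᶠ k : ℕ in atTop, ‖a ^ q k * (k : ℝ) ^ 2‖ ≤ a⁻¹ * ‖1 / (k : ℝ) ^ 2‖ := by
    filter_upwards [hlim.eventually_le_const zero_lt_one, eventually_ge_atTop 1] with k hk hk1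
    have hk0 : (0 : ℝ) < k := by exact_mod_cast hk1
    -- rounding costs at most one factor `a`
    have h1 : a ^ q k ≤ a⁻¹ * Real.exp (-(-Real.log a) * (k : ℝ) ^ s) := by
      rw [neg_neg, ← Real.rpow_def_of_pos ha.1, ← Real.rpow_neg_one, ← Real.rpow_add ha.1,
        ← Real.rpow_natCast]
      refine Real.rpow_le_rpow_of_exponent_ge ha.1 ha.2.le ?_
      linarith [rpow_sub_one_le_of_round hq hk1]
    have h2 : (k : ℝ) ^ (4 : ℝ) = (k : ℝ) ^ 4 := by exact_mod_cast Real.rpow_natCast (k : ℝ) 4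
    rw [h2] at hk
    have hai := inv_pos.2 ha.1
    have ha0 := pow_pos ha.1 (q k)
    rw [Real.norm_of_nonneg (by positivity), Real.norm_of_nonneg (by positivity), mul_one_div,
      le_div_iff₀ (by positivity)]
    calc a ^ q k * (k : ℝ) ^ 2 * (k : ℝ) ^ 2 = (k : ℝ) ^ 4 * a ^ q k := by ring
      _ ≤ (k : ℝ) ^ 4 * (a⁻¹ * Real.exp (-(-Real.log a) * (k : ℝ) ^ s)) := by gcongr
      _ = a⁻¹ * ((k : ℝ) ^ 4 * Real.exp (-(-Real.log a) * (k : ℝ) ^ s)) := by ring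
      _ ≤ a⁻¹ * 1 := by gcongr
      _ = a⁻¹ := mul_one _
  exact summable_of_isBigO_nat (Real.summable_one_div_nat_pow.2 one_lt_two)
    (Asymptotics.IsBigO.of_bound _ hle)

theorem averagingError_nonneg (hN : 2 ≤ N) (hV : InfoExchange G V ζ T) {B γ Λ : ℝ} (hB : 0 < B)
    (hγ : 0 < γ) (hΛ : 0 ≤ Λ) (k : ℕ) : 0 ≤ averagingError N T ζ B γ q Λ k := by
  have hG := hV.Gam_pos hN
  have hα := (hV.alph_mem hN).1
  unfold averagingError
  positivity

theorem exists_sum_averagingError_le (hN : 2 ≤ N) (hV : InfoExchange G V ζ T) {B γ Λ : ℝ}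
    (hB : 0 < B) (hγ : 0 < γ) (hΛ : 0 ≤ Λ) (hs : 0 < s)
    (hq : ∀ k : ℕ, 1 ≤ k → q k = ⌊(k : ℝ) ^ s⌋₊ ∨ q k = ⌈(k : ℝ) ^ s⌉₊) :
    ∃ C, ∀ K : ℕ, ∑ k ∈ Finset.Icc 1 K, averagingError N T ζ B γ q Λ k ≤ C := by
  have hG := hV.Gam_pos hN
  have hα := hV.alph_mem hN
  have hα0 := hα.1
  have hsum := summable_pow_mul_sq hs hq hα
  have h : Summable fun k => averagingError N T ζ B γ q Λ k := by
    refine Summable.of_nonneg_of_le (averagingError_nonneg hN hV hB hγ hΛ) (fun k => ?_)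
      (hsum.mul_left (8 * (N : ℝ) ^ 2 * B ^ 2 * Gam N T ζ *
        (2 * γ + (γ + Λ / (2 * (√(N : ℝ) * B))))))
    have hk : (k : ℝ) ≤ (k : ℝ) ^ 2 := by exact_mod_cast Nat.le_self_pow two_ne_zero k
    calc averagingError N T ζ B γ q Λ k
        ≤ 8 * (N : ℝ) ^ 2 * B ^ 2 * Gam N T ζ * (alph N T ζ ^ q k *
          (2 * γ * (k : ℝ) ^ 2 + (γ + Λ / (2 * (√(N : ℝ) * B))) * (k : ℝ) ^ 2)) := by
          unfold averagingError
          gcongr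
      _ = _ := by ring
  exact ⟨∑' k, averagingError N T ζ B γ q Λ k, fun K =>
    h.sum_le_tsum _ fun k _ => averagingError_nonneg hN hV hB hγ hΛ k⟩

/-- The choice `Λ = 2 ‖λ*‖` gives the error term of the convergence bounds. -/
theorem sum_averagingError_eq_Theta3 {n : ℕ} (B γ : ℝ) (ls : Stack N n) (K : ℕ) :
    ∑ k ∈ Finset.Icc 1 K, averagingError N T ζ B γ q (2 * ‖ls‖) k = Theta3 T ζ B γ q ls K := by
  unfold averagingError Theta3
  rw [← Finset.mul_sum]
  simp only [mul_div_mul_left _ _ (two_ne_zero (α := ℝ))]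

theorem totalSteps_le (hs : 0 < s)
    (hq : ∀ k : ℕ, 1 ≤ k → q k = ⌊(k : ℝ) ^ s⌋₊ ∨ q k = ⌈(k : ℝ) ^ s⌉₊) {K : ℕ} (hK : 1 ≤ K) :
    (totalSteps q K : ℝ) ≤ 2 * (K : ℝ) ^ (1 + s) := by
  have hK0 : (1 : ℝ) ≤ K := by exact_mod_cast hK
  have hone : (1 : ℝ) ≤ (K : ℝ) ^ s := Real.one_le_rpow hK0 hs.le
  rw [totalSteps, Nat.cast_sum]
  calc ∑ k ∈ Finset.Icc 1 K, (q k : ℝ) ≤ ∑ _k ∈ Finset.Icc 1 K, 2 * (K : ℝ) ^ s := by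
        refine Finset.sum_le_sum fun k hk => ?_
        obtain ⟨hk1, hk2⟩ := Finset.mem_Icc.1 hk
        have h1 := le_rpow_add_one_of_round hq hk1
        have h2 : (k : ℝ) ^ s ≤ (K : ℝ) ^ s :=
          Real.rpow_le_rpow (Nat.cast_nonneg k) (by exact_mod_cast hk2) hs.le
        linarith
    _ = 2 * (K : ℝ) ^ (1 + s) := by
        rw [Finset.sum_const, Nat.card_Icc, Nat.add_sub_cancel, nsmul_eq_mul,
          Real.rpow_add (by linarith), Real.rpow_one]
        ring

end Rates

/-! ### Limit points of the ergodic averages -/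

section LimitPoints

variable {N n : ℕ} {m : Fin N → ℕ} {P : Problem N n m} {L : Fin N → ℝ≥0} {B : ℝ}

theorem lowerSemicontinuous_ereal_sum {X ι : Type*} [TopologicalSpace X] (t : Finset ι)
    {g : ι → X → EReal} (hb : ∀ i x, g i x ≠ ⊥) (hg : ∀ i, LowerSemicontinuous (g i)) :
    LowerSemicontinuous fun x => ∑ i ∈ t, g i x := by
  classical
  induction t using Finset.induction_on with
  | empty =>
    simp only [Finset.sum_empty]
    exact lowerSemicontinuous_const
  | insert i t hi ih =>
    simp only [Finset.sum_insert hi]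
    exact (hg i).add' ih fun x => EReal.continuousAt_add (Or.inr (ereal_sum_ne_bot t (hb · x)))
      (Or.inl (hb i x))

theorem Problem.CompositeConvex.lowerSemicontinuous_cost (hP : P.CompositeConvex L) :
    LowerSemicontinuous P.cost := by
  refine lowerSemicontinuous_ereal_sum _ (fun i x => hP.localCost_ne_bot i (x i)) fun i => ?_
  have h1 : LowerSemicontinuous fun x : Stack N n => P.rho i (x i) :=
    (hP.rho_convex i).lsc.comp (by fun_prop)
  have h2 : Continuous fun x : Stack N n => (P.f i (x i) : EReal) :=
    continuous_coe_real_ereal.comp ((hP.f_convex i).locallyLipschitz.continuous.comp (by fun_prop))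
  exact h1.add' h2.lowerSemicontinuous fun x => EReal.continuousAt_add
    (Or.inr (EReal.coe_ne_bot _)) (Or.inl ((hP.rho_convex i).ne_bot _))

theorem continuous_consensusResidual : Continuous (consensusResidual : Stack N n → Stack N n) := by
  unfold consensusResidual constStack blockMean
  fun_prop

/-- A consensual feasible point whose cost is at most the saddle point cost is optimal. -/
theorem Problem.IsSaddleData.isOptimal (hP : P.CompositeConvex L) {xs ls : Stack N n}
    {θs : ∀ i, Vec (m i)} (hs : P.IsSaddleData B xs θs ls) (hN : 0 < N)
    (hdom : ∀ i, dom (P.rho i) ⊆ Metric.closedBall 0 B) {z : Vec n} (hz : P.Feasible z)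
    (hcost : P.cost (constStack N z) ≤ P.cost xs) : P.IsOptimal z := by
  have hne : P.cost xs ≠ ⊤ := by
    rw [hP.cost_eq hs.mem_dom]
    exact EReal.coe_ne_top _
  refine ⟨hz, ne_top_of_le_ne_top hne hcost, fun y hy => hcost.trans ?_⟩
  by_cases htop : ∑ i, P.localCost i y = ⊤
  · rw [htop]
    exact le_top
  · have hyd := hP.mem_dom_of_sum_ne_top (x := fun _ => y) htop
    have h1 := hs.realCost_le (constStack N y) hyd y (by simpa using hdom ⟨0, hN⟩ (hyd _))
    rw [sub_self, inner_zero_right, add_zero] at h1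
    have h2 : ∑ i, ⟪θs i, P.A i (constStack N y i) - P.b i⟫_ℝ ≤ 0 :=
      Finset.sum_nonpos fun i _ => hs.mem_polar i _ (hy i)
    have h3 : ((P.realCost xs : ℝ) : EReal) ≤ (P.realCost (constStack N y) : ℝ) :=
      EReal.coe_le_coe_iff.2 (by linarith)
    rw [← hP.cost_eq hs.mem_dom, ← hP.cost_eq (x := constStack N y) hyd] at h3
    exact h3

/-- Limit points of an asymptotically consensual and feasible sequence whose cost exceeds the
saddle point cost by at most `C / K` are optimal. -/
theorem Problem.IsSaddleData.isOptimal_of_mapClusterPt (hP : P.CompositeConvex L)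
    {xs ls : Stack N n} {θs : ∀ i, Vec (m i)} (hs : P.IsSaddleData B xs θs ls) (hN : 0 < N)
    (hdom : ∀ i, dom (P.rho i) ⊆ Metric.closedBall 0 B) {u : ℕ → Stack N n} {C : ℝ}
    (hu : ∀ K, 1 ≤ K → ∀ i, u K i ∈ dom (P.rho i))
    (hcost : ∀ K : ℕ, 1 ≤ K → P.realCost (u K) - P.realCost xs ≤ C / K)
    (hres : ∀ K : ℕ, 1 ≤ K → ‖consensusResidual (u K)‖ ≤ C / K)
    (hfeas : ∀ K : ℕ, 1 ≤ K → ∀ i,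
      Metric.infDist (P.A i (u K i) - P.b i) (P.cone i : Set (Vec (m i))) ≤ C / K)
    {z : Stack N n} (hz : MapClusterPt z atTop u) :
    ∃ xo : Vec n, (∀ i, z i = xo) ∧ P.IsOptimal xo := by
  obtain ⟨φ, hφ, hlim⟩ := hz.tendsto_subseq
  have hφ' := hφ.tendsto_atTop
  have hC : Tendsto (fun k => C / (φ k : ℝ)) atTop (𝓝 0) :=
    (tendsto_const_div_atTop_nhds_zero_nat C).comp hφ'
  have hev : ∀ᶠ k in atTop, 1 ≤ φ k := hφ'.eventually_ge_atTop 1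
  have h1 : ‖consensusResidual z‖ ≤ 0 :=
    le_of_tendsto_of_tendsto ((continuous_consensusResidual.norm.tendsto z).comp hlim) hC
      (hev.mono fun k hk => hres _ hk)
  have hz' : z = constStack N (blockMean z) :=
    sub_eq_zero.1 (norm_eq_zero.1 (le_antisymm h1 (norm_nonneg _)))
  refine ⟨blockMean z, fun i => congrArg (fun y : Stack N n => y i) hz', ?_⟩
  refine hs.isOptimal hP hN hdom (fun i => ?_) ?_
  · have hcont : Continuous fun y : Stack N n =>
        Metric.infDist (P.A i (y i) - P.b i) (P.cone i : Set (Vec (m i))) :=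
      (Metric.continuous_infDist_pt _).comp (by fun_prop)
    have h2 := le_of_tendsto_of_tendsto ((hcont.tendsto z).comp hlim) hC
      (hev.mono fun k hk => hfeas _ hk i)
    have h3 : P.A i (z i) - P.b i ∈ (P.cone i : Set (Vec (m i))) :=
      ((P.cone i).isClosed.mem_iff_infDist_zero ⟨0, (P.cone i).zero_mem⟩).2
        (le_antisymm h2 Metric.infDist_nonneg)
    rw [hz'] at h3
    exact h3
  · rw [← hz', hP.cost_eq hs.mem_dom]
    by_contra! hlt
    obtain ⟨c, hc1, hc2⟩ := EReal.lt_iff_exists_real_btwn.1 hlt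
    have hc1 := EReal.coe_lt_coe_iff.1 hc1
    have h2 := hlim.eventually (hP.lowerSemicontinuous_cost z c hc2)
    have h3 : ∀ᶠ k in atTop, C / (φ k : ℝ) < c - P.realCost xs :=
      hC.eventually_lt_const (by linarith)
    obtain ⟨k, hk1, hk2, hk3⟩ := (h2.and (h3.and hev)).exists
    simp only [Function.comp_apply] at hk1
    rw [hP.cost_eq (hu _ hk3), gt_iff_lt, EReal.coe_lt_coe_iff] at hk1
    linarith [hcost _ hk3]

end LimitPoints

end DPDA

theorem theorem3 {N n : ℕ} {m : Fin N → ℕ} (hN : 2 ≤ N)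
    -- the problem, with compact domains contained in the ball of radius `B`
    (P : DPDA.Problem N n m) (L : Fin N → ℝ≥0) (hP : P.CompositeConvex L)
    (B : ℝ) (hB : 0 < B) (hdom : ∀ i, DPDA.dom (P.rho i) ⊆ Metric.closedBall 0 B)
    -- the time-varying network
    (G : ℕ → SimpleGraph (Fin N)) (V : ℕ → Matrix (Fin N) (Fin N) ℝ) (ζ : ℝ) (T : ℕ)
    (hV : DPDA.InfoExchange G V ζ T)
    -- `k^{1/p}` consensus steps (rounded to an integer) at iteration `k ≥ 1`
    (p : ℚ) (hp : 1 ≤ p) (q : ℕ → ℕ)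
    (hq : ∀ k : ℕ, 1 ≤ k →
      q k = ⌊(k : ℝ) ^ (1 / (p : ℝ))⌋₊ ∨ q k = ⌈(k : ℝ) ^ (1 / (p : ℝ))⌉₊)
    -- the step sizes
    (τ κ : Fin N → ℝ) (γ : ℝ) (hτ : ∀ i, 0 < τ i) (hκ : ∀ i, 0 < κ i) (hγ : 0 < γ)
    (hstep : ∀ i, ‖P.A i‖ ^ 2 ≤ (1 / τ i - (L i : ℝ) - γ) * (1 / κ i))
    -- a saddle point
    (xs : DPDA.Stack N n) (θs : ∀ i, DPDA.Vec (m i)) (ls : DPDA.Stack N n)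
    (hsaddle : P.IsSaddle B xs θs ls)
    -- the iterates
    (x μ : ℕ → DPDA.Stack N n) (θ : ℕ → ∀ i, DPDA.Vec (m i))
    (hx0 : ∀ i, x 0 i ∈ DPDA.dom (P.rho i)) (hθ0 : ∀ i, θ 0 i = 0)
    (halg : DPDA.IsDPDAD P B V q τ κ γ x μ θ) :
    -- limit points of the ergodic averages
    (∃ z, MapClusterPt z atTop (DPDA.ergodic x)) ∧
    (∀ z, MapClusterPt z atTop (DPDA.ergodic x) →
      ∃ xo : DPDA.Vec n, (∀ i, z i = xo) ∧ P.IsOptimal xo) ∧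
    -- error bounds; the costs that are compared are finite
    P.cost xs ≠ ⊤ ∧
    (∀ K : ℕ, 1 ≤ K →
      DPDA.infeasibility P θs ls (DPDA.ergodic x K)
          ≤ (DPDA.Theta2 τ κ γ (x 0) xs θs ls + DPDA.Theta3 T ζ B γ q ls K) / K ∧
      P.cost (DPDA.ergodic x K) ≠ ⊤ ∧
      |(P.cost (DPDA.ergodic x K)).toReal - (P.cost xs).toReal|
          ≤ (DPDA.Theta2 τ κ γ (x 0) xs θs ls + DPDA.Theta3 T ζ B γ q ls K) / K) ∧
    -- the accumulated error is bounded, hence the rate `O(1/K)`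
    BddAbove (Set.range (DPDA.Theta3 T ζ B γ q ls)) ∧
    (fun K : ℕ => DPDA.Theta3 T ζ B γ q ls K / (K : ℝ)) =O[atTop] (fun K : ℕ => 1 / (K : ℝ)) ∧
    (fun K : ℕ => DPDA.infeasibility P θs ls (DPDA.ergodic x K))
      =O[atTop] (fun K : ℕ => 1 / (K : ℝ)) ∧
    (fun K : ℕ => (P.cost (DPDA.ergodic x K)).toReal - (P.cost xs).toReal)
      =O[atTop] (fun K : ℕ => 1 / (K : ℝ)) ∧
    -- the number of communications per node in the first `K` iterations
    (fun K : ℕ => (DPDA.totalSteps q K : ℝ))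
      =O[atTop] (fun K : ℕ => (K : ℝ) ^ (1 + 1 / (p : ℝ))) := by
  have hN0 : 0 < N := by omega
  have hs : (0 : ℝ) < 1 / (p : ℝ) := by
    have : (0 : ℝ) < (p : ℝ) := by exact_mod_cast lt_of_lt_of_le one_pos hp
    positivity
  have hsd := DPDA.Problem.IsSaddle.isSaddleData hP hN0 hB.le hsaddle
  have hx := halg.mem_dom hP hτ hx0
  have hxB : ∀ k i, ‖x k i‖ ≤ B := fun k i => by simpa using hdom i (hx k i)
  -- the saddle point is the stack of one feasible vector `y`
  obtain ⟨y, rfl⟩ : ∃ y : DPDA.Vec n, xs = DPDA.constStack N y :=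
    ⟨DPDA.blockMean xs, PiLp.ext hsd.consensus⟩
  have hyB : ‖y‖ ≤ B := by simpa using hdom ⟨0, hN0⟩ (hsd.mem_dom ⟨0, hN0⟩)
  have hresid := fun {M : ℝ} (hM : 0 ≤ M) {Mθ : Fin N → ℝ} (hMθ : ∀ i, 0 ≤ Mθ i) {K : ℕ}
      (hK : 1 ≤ K) =>
    halg.mul_residual_le hN hP hB hV hτ hκ hγ hstep hx hxB hθ0 hsd.mem_dom hyB hsd.feasible hM hMθ
      hK
  have hud : ∀ K, 1 ≤ K → ∀ i, DPDA.ergodic x K i ∈ DPDA.dom (P.rho i) := fun K hK =>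
    DPDA.ergodic_mem_dom hP hx hK
  have huB : ∀ K, 1 ≤ K → ∀ i, ‖DPDA.ergodic x K i‖ ≤ B := fun K hK i => by
    simpa using hdom i (hud K hK i)
  have hlow := fun {K : ℕ} (hK : 1 ≤ K) => hsd.realCost_sub_le hN0 (hud K hK) (huB K hK)
  have hinf : ∀ u : DPDA.Stack N n, DPDA.infeasibility P θs ls u ≤
      ∑ i, ‖θs i‖ * Metric.infDist (P.A i (u i) - P.b i) (P.cone i : Set (DPDA.Vec (m i)))
        + ‖ls‖ * ‖DPDA.consensusResidual u‖ := fun u => by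
    have := mul_le_mul_of_nonneg_left (DPDA.infDist_consensusSet_le u) (norm_nonneg ls)
    unfold DPDA.infeasibility
    linarith
  have hinf0 : ∀ u : DPDA.Stack N n, 0 ≤ DPDA.infeasibility P θs ls u := fun u =>
    add_nonneg (mul_nonneg (norm_nonneg _) Metric.infDist_nonneg)
      (Finset.sum_nonneg fun i _ => mul_nonneg (norm_nonneg _) Metric.infDist_nonneg)
  -- multipliers twice as long as the optimal ones give the error bounds
  have hbound : ∀ K : ℕ, 1 ≤ K →
      ∑ i, ‖θs i‖ * Metric.infDist (P.A i (DPDA.ergodic x K i) - P.b i)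
          (P.cone i : Set (DPDA.Vec (m i))) + ‖ls‖ * ‖DPDA.consensusResidual (DPDA.ergodic x K)‖
        ≤ (DPDA.Theta2 τ κ γ (x 0) (DPDA.constStack N y) θs ls + DPDA.Theta3 T ζ B γ q ls K) / K ∧
      |P.realCost (DPDA.ergodic x K) - P.realCost (DPDA.constStack N y)|
        ≤ (DPDA.Theta2 τ κ γ (x 0) (DPDA.constStack N y) θs ls + DPDA.Theta3 T ζ B γ q ls K) / K := by
    intro K hK
    have hK0 : (0 : ℝ) < K := by exact_mod_cast hK
    have h1 := hresid (M := 2 * ‖ls‖) (by positivity) (Mθ := fun i => 2 * ‖θs i‖)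
      (fun i => by positivity) hK
    have h2 : ∑ i, (1 / τ i * ‖y - x 0 i‖ ^ 2 + 1 / κ i * (2 * ‖θs i‖) ^ 2)
        + 1 / (2 * γ) * (2 * ‖ls‖) ^ 2 + 2 * ‖ls‖ * ‖x 0 - DPDA.constStack N y‖
        = DPDA.Theta2 τ κ γ (x 0) (DPDA.constStack N y) θs ls := by
      have h3 : ∀ i, 1 / τ i * ‖y - x 0 i‖ ^ 2 + 1 / κ i * (2 * ‖θs i‖) ^ 2
          = 1 / τ i * ‖DPDA.constStack N y i - x 0 i‖ ^ 2 + 4 / κ i * ‖θs i‖ ^ 2 := fun i => by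
        rw [DPDA.constStack_apply]; ring
      simp only [DPDA.Theta2, h3]
      field_simp
      ring
    rw [h2, DPDA.sum_averagingError_eq_Theta3, ← le_div_iff₀' hK0] at h1
    have h4 : ∑ i, 2 * ‖θs i‖ * Metric.infDist (P.A i (DPDA.ergodic x K i) - P.b i)
          (P.cone i : Set (DPDA.Vec (m i)))
        = 2 * ∑ i, ‖θs i‖ * Metric.infDist (P.A i (DPDA.ergodic x K i) - P.b i)
          (P.cone i : Set (DPDA.Vec (m i))) := by
      rw [Finset.mul_sum]
      exact Finset.sum_congr rfl fun i _ => mul_assoc _ _ _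
    rw [h4] at h1
    have h5 := hlow hK
    have h6 := (hinf0 (DPDA.ergodic x K)).trans (hinf _)
    exact ⟨by linarith, abs_le.2 ⟨by linarith, by linarith⟩⟩
  obtain ⟨C3, hC3⟩ := DPDA.exists_sum_averagingError_le hN hV hB hγ
    (by positivity : 0 ≤ 2 * ‖ls‖) hs hq
  simp only [DPDA.sum_averagingError_eq_Theta3] at hC3
  have hT3 : ∀ K, 0 ≤ DPDA.Theta3 T ζ B γ q ls K := fun K => by
    rw [← DPDA.sum_averagingError_eq_Theta3]
    exact Finset.sum_nonneg fun k _ =>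
      DPDA.averagingError_nonneg hN hV hB hγ (by positivity) k
  have hcosts := hP.cost_eq hsd.mem_dom
  have hcostK := fun {K : ℕ} (hK : 1 ≤ K) => hP.cost_eq (hud K hK)
  -- hence both error bounds are at most a constant over `K`
  have hrate : ∀ K : ℕ, 1 ≤ K →
      (DPDA.Theta2 τ κ γ (x 0) (DPDA.constStack N y) θs ls + DPDA.Theta3 T ζ B γ q ls K) / K ≤
        (DPDA.Theta2 τ κ γ (x 0) (DPDA.constStack N y) θs ls + C3) * ‖1 / (K : ℝ)‖ := by
    intro K hK
    have hK0 : (0 : ℝ) < K := by exact_mod_cast hK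
    rw [Real.norm_of_nonneg (by positivity), mul_one_div]
    have := hC3 K
    gcongr
  refine ⟨?_, fun z hz => ?_, ?_, fun K hK => ⟨?_, ?_, ?_⟩, ⟨C3, ?_⟩, ?_, ?_, ?_, ?_⟩
  · have hmem : ∀ᶠ K in atTop, DPDA.ergodic x K ∈
        Metric.closedBall (0 : DPDA.Stack N n) (√(N : ℝ) * B) := by
      filter_upwards [eventually_ge_atTop 1] with K hK
      simpa using DPDA.norm_stack_le hB.le (huB K hK)
    obtain ⟨z, -, hz⟩ := (isCompact_closedBall (0 : DPDA.Stack N n)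
      (√(N : ℝ) * B)).exists_mapClusterPt_of_frequently hmem.frequently
    exact ⟨z, hz⟩
  · -- multipliers longer than the optimal ones by one bound the unweighted residuals
    obtain ⟨C1, hC1⟩ := DPDA.exists_sum_averagingError_le hN hV hB hγ
      (by positivity : 0 ≤ ‖ls‖ + 1) hs hq
    set C2 := ∑ i, (1 / τ i * ‖y - x 0 i‖ ^ 2 + 1 / κ i * (‖θs i‖ + 1) ^ 2)
      + 1 / (2 * γ) * (‖ls‖ + 1) ^ 2 + (‖ls‖ + 1) * ‖x 0 - DPDA.constStack N y‖ + C1 with hC2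
    have key : ∀ K : ℕ, 1 ≤ K →
        P.realCost (DPDA.ergodic x K) - P.realCost (DPDA.constStack N y)
        + ∑ i, ‖θs i‖ * Metric.infDist (P.A i (DPDA.ergodic x K i) - P.b i)
            (P.cone i : Set (DPDA.Vec (m i)))
        + ‖ls‖ * ‖DPDA.consensusResidual (DPDA.ergodic x K)‖
        + ∑ i, Metric.infDist (P.A i (DPDA.ergodic x K i) - P.b i)
            (P.cone i : Set (DPDA.Vec (m i)))
        + ‖DPDA.consensusResidual (DPDA.ergodic x K)‖ ≤ C2 / K := by
      intro K hK
      have hK0 : (0 : ℝ) < K := by exact_mod_cast hK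
      have h1 := hresid (M := ‖ls‖ + 1) (by positivity) (Mθ := fun i => ‖θs i‖ + 1)
        (fun i => by positivity) hK
      have h2 := h1.trans (add_le_add_right (hC1 K) _)
      rw [← hC2, ← le_div_iff₀' hK0] at h2
      simp only [add_mul, one_mul, Finset.sum_add_distrib] at h2
      linarith
    have hd0 : ∀ K, 0 ≤ ∑ i, Metric.infDist (P.A i (DPDA.ergodic x K i) - P.b i)
        (P.cone i : Set (DPDA.Vec (m i))) := fun K =>
      Finset.sum_nonneg fun i _ => Metric.infDist_nonneg
    refine hsd.isOptimal_of_mapClusterPt hP hN0 hdom (C := C2) hud (fun K hK => ?_)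
      (fun K hK => ?_) (fun K hK i => ?_) hz
    · have := key K hK
      have := (hinf0 (DPDA.ergodic x K)).trans (hinf _)
      linarith [hd0 K, norm_nonneg (DPDA.consensusResidual (DPDA.ergodic x K))]
    · linarith [key K hK, hlow hK, hd0 K]
    · have := Finset.single_le_sum (f := fun i => Metric.infDist
        (P.A i (DPDA.ergodic x K i) - P.b i) (P.cone i : Set (DPDA.Vec (m i))))
        (fun i _ => Metric.infDist_nonneg) (Finset.mem_univ i)
      linarith [key K hK, hlow hK, norm_nonneg (DPDA.consensusResidual (DPDA.ergodic x K))]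
  · rw [hcosts]
    exact EReal.coe_ne_top _
  · exact (hinf _).trans (hbound K hK).1
  · rw [hcostK hK]
    exact EReal.coe_ne_top _
  · rw [hcostK hK, hcosts, EReal.toReal_coe, EReal.toReal_coe]
    exact (hbound K hK).2
  · rintro _ ⟨K, rfl⟩
    exact hC3 K
  · refine Asymptotics.IsBigO.of_bound C3 (Eventually.of_forall fun K => ?_)
    rw [div_eq_mul_one_div, norm_mul, Real.norm_of_nonneg (hT3 K)]
    exact mul_le_mul_of_nonneg_right (hC3 K) (norm_nonneg _)
  · refine Asymptotics.IsBigO.of_bound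
      (DPDA.Theta2 τ κ γ (x 0) (DPDA.constStack N y) θs ls + C3)
      ((eventually_ge_atTop 1).mono fun K hK => ?_)
    rw [Real.norm_of_nonneg (hinf0 _)]
    exact ((hinf _).trans (hbound K hK).1).trans (hrate K hK)
  · refine Asymptotics.IsBigO.of_bound
      (DPDA.Theta2 τ κ γ (x 0) (DPDA.constStack N y) θs ls + C3)
      ((eventually_ge_atTop 1).mono fun K hK => ?_)
    rw [hcostK hK, hcosts, EReal.toReal_coe, EReal.toReal_coe, Real.norm_eq_abs]
    exact (hbound K hK).2.trans (hrate K hK)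
  · refine Asymptotics.IsBigO.of_bound 2 ((eventually_ge_atTop 1).mono fun K hK => ?_)
    rw [Real.norm_of_nonneg (by positivity), Real.norm_of_nonneg (by positivity)]
    exact DPDA.totalSteps_le hs hq hK
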